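/- Let $1<p<\infty$, $1/p+1/q=1$, and let $\mathbb T=\{t\in\mathbb C:|t|=1\}$. For $f\in L^1(\mathbb T)$ put $f_k=\frac1{2\pi}\int_0^{2\pi}f(e^{i\theta})e^{-ik\theta}\,d\theta$ ($k\in\mathbb Z$) and $\tilde f(t)=f(t^{-1})$. For $1\le r\le\infty$ let $H^r(\mathbb T)=\{f\in L^r(\mathbb T): f_k=0 \text{ for } k<0\}$, let $P:\sum_{k\in\mathbb Z} f_kt^k\mapsto\sum_{k\ge0}f_kt^k$ be the Riesz projection of $L^p(\mathbb T)$ onto $H^p(\mathbb T)$, and let $(Jf)(t)=t^{-1}f(t^{-1})$. For $a\in L^\infty(\mathbb T)$ define the Toeplitz and Hankel operators on $H^p(\mathbb T)$ by $T(a)f=P(af)$ and $H(a)f=P(a\,Jf)$. Let $GL^\infty(\mathbb T)$ be the group of invertible elements of $L^\infty(\mathbb T)$. Let $a,b\in GL^\infty(\mathbb T)$ satisfy $a\tilde a=b\tilde b$ (almost everywhere), and put $$c=\frac ab=\frac{\tilde b}{\tilde a},\qquad d=\frac{\tilde a}b=\frac{\tilde b}a .$$ Suppose that there are $n,m\in\mathbb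 Z$ and functions $c_+,d_+$ on $\mathbb T$ with $$c(t)=c_+(t)\,t^{2n}\,c_+^{-1}(t^{-1}),\qquad d(t)=d_+(t)\,t^{2m}\,d_+^{-1}(t^{-1})$$ almost everywhere and $$(1+t)c_+\in H^q(\mathbb T),\quad (1-t)c_+^{-1}\in H^p(\mathbb T),\quad (1+t)d_+\in H^p(\mathbb T),\quad (1-t)d_+^{-1}\in H^q(\mathbb T).$$ Put $\rho=t^{-m-n}(1+t)(1+t^{-1})\,\tilde c_+\,\tilde d_+\,b^{-1}$ and, if $n,m>0$, let $A_{n,m}$ be the $n\times m$ matrix $$A_{n,m}=\left[\rho_{i-j}+\rho_{i+j}\right]_{0\le i\le n-1,\ 0\le j\le m-1}.$$ Suppose that $T(a)+H(b)$ is Fredholm on $H^p(\mathbb T)$. Then $\rho\in L^1(\mathbb T)$ and $$\dim\ker(T(a)+H(b))=\begin{cases}0&\text{if } n>0,\ m\le0,\\ -n&\text{if } n\le0,\ m\le0,\\ \dim\ker A_{n,m}&\text{if } n>0,\ m>0,\\ m-n&\text{if } n\le0,\ m>0,\end{cases}$$ $$\dim\ker(T(a)+H(b))^*=\begin{cases}0&\text{if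 } m>0,\ n\le0,\\ -m&\text{if } m\le0,\ n\le0,\\ \dim\ker (A_{n,m})^T&\text{if } m>0,\ n>0,\\ n-m&\text{if } m\le0,\ n>0,\end{cases}$$ where $(T(a)+H(b))^*$ is the adjoint operator on the dual space of $H^p(\mathbb T)$. In particular, the Fredholm index $\dim\ker(T(a)+H(b))-\dim\big(H^p(\mathbb T)/\operatorname{im}(T(a)+H(b))\big)$ equals $m-n$. -/

import Mathlib

open MeasureTheory
open scoped ENNReal

noncomputable section

/-- The unit circle, as `ℝ/2πℤ`; the class of `θ` stands for the point `t = e^{iθ}`.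
In particular `fourier k` is the function `t ↦ t^k`, and `x ↦ -x` is `t ↦ t⁻¹`. -/
abbrev UnitCircle : Type := AddCircle (2 * Real.pi)

instance fact_zero_lt_two_pi : Fact (0 < 2 * Real.pi) := ⟨by positivity⟩

/-- Normalised arc length `dθ / 2π`. Mathlib's `fourierCoeff f k` is the integral of
`t^(-k) f(t)` against this measure. -/
abbrev circleMeasure : Measure UnitCircle := AddCircle.haarAddCircle

/-! The next section proves the theorem of M. Riesz: for `1 < p < ∞` the map
`∑ f_k t^k ↦ ∑_{k ≥ 0} f_k t^k` is bounded on `L^p`. It is what makes the Riesz projection, hence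
Toeplitz and Hankel operators on `H^p`, well defined. -/

section RieszTheorem

open Real
open scoped ComplexConjugate

namespace Riesz

theorem key_ineq (p : ℝ) (hp1 : 1 < p) (hp2 : p ≤ 2) : ∃ A B : ℝ, 0 ≤ A ∧ 0 ≤ B ∧
    ∀ z : ℂ, 0 < z.re → ‖z‖ ^ p ≤ A * z.re ^ p - B * (z ^ (p : ℂ)).re := by
  obtain ⟨t, ht1, ht2⟩ : ∃ t, π / (2 * p) < t ∧ t < π / 2 :=
    exists_between (by
      apply div_lt_div_of_pos_left pi_pos (by norm_num) (by linarith))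
  have ht0 : 0 < t := lt_trans (by positivity) ht1
  have hpt : π / 2 < p * t := by
    rw [div_lt_iff₀ (by positivity)] at ht1
    linarith
  have hct : 0 < cos t := cos_pos_of_mem_Ioo ⟨by linarith [pi_pos], ht2⟩
  have hcpt : cos (p * t) < 0 :=
    cos_neg_of_pi_div_two_lt_of_lt hpt (by nlinarith [pi_pos])
  set B := (-cos (p * t))⁻¹ with hB
  have hB0 : 0 < B := inv_pos.2 (by linarith)
  have hctp : 0 < cos t ^ p := rpow_pos_of_pos hct p
  refine ⟨(1 + B) / cos t ^ p, B, by positivity, hB0.le, fun z hz => ?_⟩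
  have hz0 : z ≠ 0 := by rintro rfl; simp at hz
  have hr : 0 < ‖z‖ := norm_pos_iff.2 hz0
  set φ := |Complex.arg z| with hφ
  have hφ2 : φ < π / 2 := Complex.abs_arg_lt_pi_div_two_iff.2 (Or.inl hz)
  have hφ0 : 0 ≤ φ := abs_nonneg _
  have hre : z.re = ‖z‖ * cos φ := by rw [hφ, cos_abs, Complex.norm_mul_cos_arg]
  have hcφ : 0 < cos φ := cos_pos_of_mem_Ioo ⟨by linarith [pi_pos], hφ2⟩
  have hpow : (z ^ (p : ℂ)).re = ‖z‖ ^ p * cos (p * φ) := by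
    rw [Complex.cpow_ofReal_re]
    rw [hφ, ← cos_abs (p * |z.arg|), abs_mul, abs_abs, ← abs_mul, cos_abs, mul_comm p]
  rw [hre, hpow, mul_rpow hr.le hcφ.le]
  have hrp : 0 < ‖z‖ ^ p := rpow_pos_of_pos hr p
  suffices h : 1 ≤ (1 + B) / cos t ^ p * cos φ ^ p - B * cos (p * φ) by nlinarith
  rcases le_total φ t with h | h
  · have h1 : cos t ≤ cos φ := cos_le_cos_of_nonneg_of_le_pi hφ0 (by linarith [pi_pos]) h
    have h2 : cos t ^ p ≤ cos φ ^ p := rpow_le_rpow hct.le h1 (by linarith)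
    have h3 : 1 + B ≤ (1 + B) / cos t ^ p * cos φ ^ p := by
      rw [div_mul_eq_mul_div, le_div_iff₀ hctp]
      gcongr
    nlinarith [cos_le_one (p * φ)]
  · have h1 : cos (p * φ) ≤ cos (p * t) :=
      cos_le_cos_of_nonneg_of_le_pi (by positivity) (by nlinarith [pi_pos]) (by gcongr)
    have h2 : B * cos (p * t) = -1 := by
      rw [hB, inv_neg, neg_mul, inv_mul_cancel₀ hcpt.ne]
    have h3 : 0 ≤ (1 + B) / cos t ^ p * cos φ ^ p := by positivity
    nlinarith

/-- trigonometric polynomial with multiplier -/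
def M (s : ℤ → ℝ) : (ℤ →₀ ℂ) →ₗ[ℂ] C(UnitCircle, ℂ) :=
  Finsupp.linearCombination ℂ fun k => (s k : ℂ) • fourier k

theorem M_apply (s : ℤ → ℝ) (c : ℤ →₀ ℂ) (x : UnitCircle) :
    M s c x = c.sum fun k v => v * ((s k : ℂ) * fourier k x) := by
  simp [M, Finsupp.linearCombination_apply, Finsupp.sum, ContinuousMap.sum_apply]

def cstar (c : ℤ →₀ ℂ) : ℤ →₀ ℂ :=
  (c.mapRange (starRingEnd ℂ) (map_zero _)).equivMapDomain (Equiv.neg ℤ)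

theorem cstar_apply (c : ℤ →₀ ℂ) (k : ℤ) : cstar c k = conj (c (-k)) := by
  simp [cstar, Finsupp.equivMapDomain_apply]

theorem conj_M (s : ℤ → ℝ) (c : ℤ →₀ ℂ) (x : UnitCircle) :
    conj (M s c x) = M (fun k => s (-k)) (cstar c) x := by
  rw [M_apply, M_apply, cstar, Finsupp.sum_equivMapDomain, Finsupp.sum_mapRange_index (by simp)]
  simp only [Finsupp.sum, map_sum, map_mul]
  refine Finset.sum_congr rfl fun k _ => ?_
  rw [← fourier_neg]
  simp [-fourier_apply]

theorem M_add (s t : ℤ → ℝ) (c : ℤ →₀ ℂ) : M s c + M t c = M (fun k => s k + t k) c := by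
  ext x
  simp only [ContinuousMap.add_apply, M_apply, Finsupp.sum, ← Finset.sum_add_distrib]
  exact Finset.sum_congr rfl fun k _ => by push_cast; ring

def sgn (k : ℤ) : ℝ := if k = 0 then 1 else if 0 < k then 2 else 0
def pos (k : ℤ) : ℝ := if 0 ≤ k then 1 else 0
def neg (k : ℤ) : ℝ := if k ≤ 0 then 1 else 0
def one (_ : ℤ) : ℝ := 1

theorem re_M_sgn (c : ℤ →₀ ℂ) (hc : cstar c = c) (x : UnitCircle) :
    (M sgn c x).re = (M one c x).re := by
  have h1 := conj_M sgn c x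
  have h2 := M_add sgn (fun k => sgn (-k)) c
  have h3 : M (fun k => sgn k + sgn (-k)) c = M one c + M one c := by
    rw [M_add]; congr 2; funext k; simp only [sgn, one]; split_ifs <;> first | omega | norm_num
  rw [h3] at h2
  have h4 := congrArg (fun f : C(UnitCircle, ℂ) => (f x).re) h2
  rw [hc] at h1
  simp only [ContinuousMap.add_apply, ← h1, Complex.add_re, Complex.conj_re] at h4
  linarith

theorem im_M_one (c : ℤ →₀ ℂ) (hc : cstar c = c) (x : UnitCircle) :
    (M one c x).im = 0 := by
  have h1 := conj_M one c x
  rw [hc] at h1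
  exact Complex.conj_eq_iff_im.1 h1

/-- the analytic extension -/
def G (c : ℤ →₀ ℂ) (z : ℂ) : ℂ := c.sum fun k v => v * ((sgn k : ℂ) * z ^ k.natAbs)

theorem G_fourier (c : ℤ →₀ ℂ) (x : UnitCircle) : G c (fourier 1 x) = M sgn c x := by
  rw [G, M_apply]
  refine Finset.sum_congr rfl fun k _ => ?_
  rcases lt_or_ge k 0 with h | h
  · simp [sgn, h.ne, h.not_gt]
  · lift k to ℕ using h
    simp [AddCircle.toCircle_nsmul]

theorem G_diff (c : ℤ →₀ ℂ) : Differentiable ℂ (G c) := by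
  unfold G Finsupp.sum; fun_prop

theorem G_zero (c : ℤ →₀ ℂ) : G c 0 = c 0 := by
  rw [G, Finsupp.sum_eq_single 0]
  · simp [sgn]
  · intro k _ hk; simp [hk]
  · simp

theorem integral_circle (f : ℂ → ℂ) :
    ∫ x : UnitCircle, f (fourier 1 x) ∂circleMeasure = circleAverage f 0 1 := by
  rw [AddCircle.integral_haarAddCircle, circleAverage,
    ← AddCircle.intervalIntegral_preimage (2 * π) 0]
  simp [AddCircle.toCircle, circleMap]

theorem sphere_fourier (z : ℂ) (hz : ‖z‖ = 1) : ∃ x : UnitCircle, (fourier 1 x : ℂ) = z := by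
  refine ⟨(z.arg : ℝ), ?_⟩
  have := Complex.norm_mul_exp_arg_mul_I z
  rw [hz] at this
  simpa [AddCircle.toCircle] using this

theorem G_re_pos (c : ℤ →₀ ℂ) (h : ∀ x, 0 < (M sgn c x).re) (z : ℂ)
    (hz : z ∈ Metric.closedBall (0 : ℂ) 1) : 0 < (G c z).re := by
  obtain ⟨x0, -, hx0⟩ := isCompact_univ.exists_isMinOn (Set.univ_nonempty (α := UnitCircle))
    (f := fun x => (M sgn c x).re) (by fun_prop)
  have h1 : ‖Complex.exp (-G c z)‖ ≤ Real.exp (-(M sgn c x0).re) := by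
    refine Complex.norm_le_of_forall_mem_frontier_norm_le (U := Metric.ball (0:ℂ) 1)
      (f := fun z => Complex.exp (-G c z)) Metric.isBounded_ball ?_ ?_ ?_
    · exact (Complex.differentiable_exp.comp (G_diff c).neg).diffContOnCl
    · intro w hw
      rw [frontier_ball _ one_ne_zero, mem_sphere_zero_iff_norm] at hw
      obtain ⟨x, rfl⟩ := sphere_fourier w hw
      rw [Complex.norm_exp, G_fourier]
      simpa using hx0 (Set.mem_univ x)
    · rwa [closure_ball _ one_ne_zero]
  rw [Complex.norm_exp] at h1
  have := Real.exp_le_exp.1 h1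
  have := h x0
  simp at *
  linarith

theorem int_bound (p : ℝ) (hp1 : 1 < p) (hp2 : p ≤ 2) : ∃ A : ℝ, 0 ≤ A ∧ ∀ c : ℤ →₀ ℂ,
    cstar c = c → (∀ x, 0 < (M one c x).re) →
    ∫ x, ‖M sgn c x‖ ^ p ∂circleMeasure ≤ A * ∫ x, ‖M one c x‖ ^ p ∂circleMeasure := by
  obtain ⟨A, B, hA, hB, key⟩ := key_ineq p hp1 hp2
  refine ⟨A, hA, fun c hc hpos => ?_⟩
  have hpos' : ∀ x, 0 < (M sgn c x).re := fun x => by rw [re_M_sgn c hc]; exact hpos x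
  have hG := G_re_pos c hpos'
  have hnorm : ∀ x, ‖M one c x‖ = (M sgn c x).re := fun x => by
    rw [re_M_sgn c hc, ← Complex.abs_re_eq_norm.2 (im_M_one c hc x), abs_of_pos (hpos x)]
  have hmean : ∫ x, (M sgn c x) ^ (p : ℂ) ∂circleMeasure = (c 0) ^ (p : ℂ) := by
    have hd : DiffContOnCl ℂ (fun z => G c z ^ (p : ℂ)) (Metric.ball 0 |1|) := by
      rw [abs_one]
      refine DifferentiableOn.diffContOnCl fun z hz => ?_
      rw [closure_ball _ one_ne_zero] at hz
      exact ((G_diff c z).cpow_const (Or.inl (hG z hz))).differentiableWithinAt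
    have := hd.circleAverage
    rw [G_zero] at this
    rw [← this, ← integral_circle]
    simp only [G_fourier]
  have hc0 : 0 ≤ ((c 0) ^ (p : ℂ)).re := by
    have h1 : conj (c 0) = c 0 := by
      conv_rhs => rw [← hc]
      simp [cstar_apply]
    have h2 : 0 < (c 0).re := by rw [← G_zero]; exact hG 0 (by simp)
    have h3 : c 0 = ((c 0).re : ℂ) := (Complex.conj_eq_iff_re.1 h1).symm
    rw [h3, ← Complex.ofReal_cpow h2.le, Complex.ofReal_re]
    positivity
  have hcont : Continuous fun x => (M sgn c x) ^ (p : ℂ) :=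
    (M sgn c).continuous.cpow continuous_const fun x => Or.inl (hpos' x)
  have hint : ∀ f : UnitCircle → ℝ, Continuous f → Integrable f circleMeasure := fun f hf =>
    hf.integrable_of_hasCompactSupport (HasCompactSupport.of_compactSpace f)
  have hintC : Integrable (fun x => (M sgn c x) ^ (p : ℂ)) circleMeasure :=
    hcont.integrable_of_hasCompactSupport (HasCompactSupport.of_compactSpace _)
  have hre : ∫ x, ((M sgn c x) ^ (p : ℂ)).re ∂circleMeasure = ((c 0) ^ (p : ℂ)).re := by
    rw [← hmean]
    exact integral_re hintC
  have hreI : Integrable (fun x => ((M sgn c x) ^ (p : ℂ)).re) circleMeasure := hintC.re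
  have hp0 : 0 ≤ p := by linarith
  calc ∫ x, ‖M sgn c x‖ ^ p ∂circleMeasure
      ≤ ∫ x, (A * ‖M one c x‖ ^ p - B * ((M sgn c x) ^ (p : ℂ)).re) ∂circleMeasure := by
        refine integral_mono (hint _ ?_) ((Integrable.const_mul (hint _ ?_) _).sub
          (hreI.const_mul _)) fun x => ?_
        · exact (M sgn c).continuous.norm.rpow_const fun _ => Or.inr hp0
        · exact (M one c).continuous.norm.rpow_const fun _ => Or.inr hp0
        · simp only [hnorm]; exact key _ (hpos' x)
    _ = A * ∫ x, ‖M one c x‖ ^ p ∂circleMeasure - B * ((c 0) ^ (p : ℂ)).re := by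
        rw [integral_sub (Integrable.const_mul (hint _ ?_) _) (hreI.const_mul _),
          integral_const_mul, integral_const_mul]
        · rw [← hre]
        · exact (M one c).continuous.norm.rpow_const fun _ => Or.inr hp0
    _ ≤ _ := by nlinarith [mul_nonneg hB hc0]


/-- `L^p`-norm of a continuous function -/
def N (p : ℝ≥0∞) [Fact (1 ≤ p)] (f : C(UnitCircle, ℂ)) : ℝ :=
  ‖ContinuousMap.toLp (E := ℂ) p circleMeasure ℂ f‖

section
variable (p : ℝ≥0∞) [hp1 : Fact (1 ≤ p)]

theorem N_eq (f : C(UnitCircle, ℂ)) : N p f = (eLpNorm f p circleMeasure).toReal := by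
  rw [N, Lp.norm_def, eLpNorm_congr_ae (ContinuousMap.coeFn_toLp (𝕜 := ℂ) circleMeasure f)]

theorem memLp (f : C(UnitCircle, ℂ)) : MemLp f p circleMeasure :=
  (Lp.memLp (ContinuousMap.toLp (E := ℂ) p circleMeasure ℂ f)).ae_eq
    (ContinuousMap.coeFn_toLp (𝕜 := ℂ) circleMeasure f)

theorem N_rpow (hp : p ≠ ∞) (f : C(UnitCircle, ℂ)) :
    N p f ^ p.toReal = ∫ x, ‖f x‖ ^ p.toReal ∂circleMeasure := by
  have hp0 : p ≠ 0 := (zero_lt_one.trans_le hp1.out).ne'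
  have : 0 < p.toReal := ENNReal.toReal_pos hp0 hp
  have h0 : 0 ≤ ∫ x, ‖f x‖ ^ p.toReal ∂circleMeasure :=
    integral_nonneg fun x => by positivity
  rw [N_eq, (memLp p f).eLpNorm_eq_integral_rpow_norm hp0 hp, ENNReal.toReal_ofReal (by positivity),
    ← rpow_mul h0, inv_mul_cancel₀ this.ne', rpow_one]

theorem N_nonneg (f : C(UnitCircle, ℂ)) : 0 ≤ N p f := norm_nonneg _

theorem N_add (f g : C(UnitCircle, ℂ)) : N p (f + g) ≤ N p f + N p g := by
  simp only [N, map_add]; exact norm_add_le _ _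

theorem N_sub (f g : C(UnitCircle, ℂ)) : N p (f - g) ≤ N p f + N p g := by
  simp only [N, map_sub]; exact norm_sub_le _ _

theorem N_smul (z : ℂ) (f : C(UnitCircle, ℂ)) : N p (z • f) = ‖z‖ * N p f := by
  simp only [N, map_smul]; exact norm_smul _ _

theorem N_mono {f g : C(UnitCircle, ℂ)} (h : ∀ x, ‖f x‖ ≤ ‖g x‖) : N p f ≤ N p g := by
  rw [N_eq, N_eq]
  exact ENNReal.toReal_mono (memLp p g).2.ne (eLpNorm_mono h)

theorem N_le (f : C(UnitCircle, ℂ)) : N p f ≤ ‖f‖ := by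
  rw [N_eq]
  have h := eLpNorm_le_of_ae_bound (p := p) (μ := circleMeasure)
    (Filter.Eventually.of_forall fun x => f.norm_coe_le_norm x)
  simp only [measure_univ, ENNReal.one_rpow, one_mul] at h
  exact ENNReal.toReal_le_of_le_ofReal (norm_nonneg _) h

theorem norm_integral_le_N (f : C(UnitCircle, ℂ)) : ‖∫ x, f x ∂circleMeasure‖ ≤ N p f := by
  refine (norm_integral_le_integral_norm _).trans ?_
  rw [N_eq, integral_norm_eq_lintegral_enorm (memLp p f).1, ← eLpNorm_one_eq_lintegral_enorm]
  exact ENNReal.toReal_mono (memLp p f).2.ne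
    (eLpNorm_le_eLpNorm_of_exponent_le hp1.out (memLp p f).1)

end

theorem N_two_M (s : ℤ → ℝ) (c : ℤ →₀ ℂ) :
    N 2 (M s c) ^ 2 = ∑ k ∈ c.support, ‖c k * (s k : ℂ)‖ ^ 2 := by
  have h : ContinuousMap.toLp (E := ℂ) 2 circleMeasure ℂ (M s c) =
      ∑ k ∈ c.support, (c k * (s k : ℂ)) • fourierLp (T := 2 * π) 2 k := by
    simp only [M, Finsupp.linearCombination_apply, Finsupp.sum, map_sum, map_smul, smul_smul]
  rw [N, h, ← RCLike.ofReal_inj (K := ℂ), RCLike.ofReal_pow, ← inner_self_eq_norm_sq_to_K (𝕜 := ℂ),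
    orthonormal_fourier.inner_sum]
  push_cast
  refine Finset.sum_congr rfl fun k _ => ?_
  exact Complex.conj_mul' _

theorem N_two_sgn (c : ℤ →₀ ℂ) : N 2 (M sgn c) ≤ 2 * N 2 (M one c) := by
  rw [← pow_le_pow_iff_left₀ (N_nonneg 2 _) (by positivity [N_nonneg 2 (M one c)]) two_ne_zero,
    mul_pow, N_two_M, N_two_M, Finset.mul_sum]
  refine Finset.sum_le_sum fun k _ => ?_
  rw [norm_mul, norm_mul, mul_pow, mul_pow]
  have : ‖(sgn k : ℂ)‖ ^ 2 ≤ 2 ^ 2 := by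
    simp only [sgn]; split_ifs <;> norm_num
  have h1 : ‖(one k : ℂ)‖ ^ 2 = 1 := by simp [one]
  rw [h1]
  nlinarith [sq_nonneg ‖c k‖]

theorem N_sgn_le (p : ℝ≥0∞) [Fact (1 ≤ p)] (hp2 : p ≤ 2) (c : ℤ →₀ ℂ) :
    N p (M sgn c) ≤ 2 * ‖M one c‖ := by
  have h1 : N p (M sgn c) ≤ N 2 (M sgn c) := by
    rw [N_eq, N_eq]
    exact ENNReal.toReal_mono (memLp 2 _).2.ne
      (eLpNorm_le_eLpNorm_of_exponent_le hp2 (memLp p _).1)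
  linarith [N_two_sgn c, N_le 2 (M one c)]

theorem dense_M : DenseRange (M one) := by
  have h := span_fourier_closure_eq_top (T := 2 * π)
  have h2 : (M one : (ℤ →₀ ℂ) →ₗ[ℂ] C(UnitCircle, ℂ)) = Finsupp.linearCombination ℂ fourier := by
    simp [M, one]
  rw [DenseRange, h2, ← LinearMap.coe_range, Finsupp.range_linearCombination,
    Submodule.dense_iff_topologicalClosure_eq_top, h]

theorem exists_approx (f : C(UnitCircle, ℂ)) (δ : ℝ) (hδ : 0 < δ) : ∃ c, ‖M one c - f‖ < δ := by
  obtain ⟨c, hc⟩ := dense_M.exists_dist_lt f hδ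
  exact ⟨c, by rwa [← dist_eq_norm, dist_comm]⟩

theorem cstar_add (c d : ℤ →₀ ℂ) : cstar (c + d) = cstar c + cstar d := by
  ext k; simp [cstar_apply]

theorem cstar_cstar (c : ℤ →₀ ℂ) : cstar (cstar c) = c := by
  ext k; simp [cstar_apply]

theorem exists_approx_pos (g : C(UnitCircle, ℂ)) (hg : ∀ x, 0 ≤ (g x).re ∧ (g x).im = 0)
    (δ : ℝ) (hδ : 0 < δ) : ∃ c, cstar c = c ∧ (∀ x, 0 < (M one c x).re) ∧ ‖M one c - g‖ ≤ δ := by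
  obtain ⟨c, hc⟩ := exists_approx (g + ContinuousMap.const _ ((δ / 2 : ℝ) : ℂ)) (δ / 2) (by linarith)
  have hx : ∀ x, ‖M one c x - (g x + ((δ / 2 : ℝ) : ℂ))‖ < δ / 2 := fun x =>
    (ContinuousMap.norm_coe_le_norm (M one c - (g + ContinuousMap.const _ ((δ / 2 : ℝ) : ℂ))) x).trans_lt hc
  have hstar : cstar ((1 / 2 : ℂ) • c) = (1 / 2 : ℂ) • cstar c := by
    ext k
    have : conj (1 / 2 : ℂ) = 1 / 2 := by rw [map_div₀, map_one, map_ofNat]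
    rw [cstar_apply, Finsupp.smul_apply, Finsupp.smul_apply, cstar_apply, smul_eq_mul, smul_eq_mul,
      map_mul, this]
  have hM : ∀ x, M one ((1 / 2 : ℂ) • c + cstar ((1 / 2 : ℂ) • c)) x = ((M one c x).re : ℂ) := by
    intro x
    have h1 := conj_M one c x
    change _ = M one (cstar c) x at h1
    rw [hstar, map_add, map_smul, map_smul]
    simp only [ContinuousMap.add_apply, ContinuousMap.smul_apply, ← h1, smul_eq_mul]
    rw [Complex.re_eq_add_conj]; ring
  have hre : ∀ x, |(M one c x).re - ((g x).re + δ / 2)| < δ / 2 := fun x => by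
    have := (Complex.abs_re_le_norm _).trans_lt (hx x)
    simpa using this
  refine ⟨(1 / 2 : ℂ) • c + cstar ((1 / 2 : ℂ) • c), ?_, fun x => ?_, ?_⟩
  · rw [cstar_add, cstar_cstar, add_comm]
  · rw [hM, Complex.ofReal_re]
    have := abs_lt.1 (hre x)
    linarith [(hg x).1]
  · rw [ContinuousMap.norm_le _ hδ.le]
    intro x
    rw [ContinuousMap.sub_apply, hM]
    have h2 : g x = ((g x).re : ℂ) := by
      apply Complex.ext <;> simp [(hg x).2]
    rw [h2, ← Complex.ofReal_sub, Complex.norm_real, norm_eq_abs, abs_le]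
    have := abs_lt.1 (hre x)
    constructor <;> linarith

theorem bound_sgn (p : ℝ≥0∞) [Fact (1 ≤ p)] (hp1 : 1 < p) (hp2 : p ≤ 2) :
    ∃ C : ℝ, 0 ≤ C ∧ ∀ c, N p (M sgn c) ≤ C * N p (M one c) := by
  have hp : p ≠ ∞ := ne_top_of_le_ne_top (by norm_num) hp2
  have hr1 : 1 < p.toReal := by
    rw [← ENNReal.toReal_one]; exact (ENNReal.toReal_lt_toReal (by simp) hp).2 hp1
  have hr2 : p.toReal ≤ 2 := by
    have := ENNReal.toReal_mono (by simp) hp2; simpa using this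
  have hr0 : 0 < p.toReal := by linarith
  obtain ⟨A, hA, hb⟩ := int_bound p.toReal hr1 hr2
  set A' := A ^ p.toReal⁻¹ with hA'
  have hA'0 : 0 ≤ A' := by positivity
  have hbd : ∀ c, cstar c = c → (∀ x, 0 < (M one c x).re) →
      N p (M sgn c) ≤ A' * N p (M one c) := by
    intro c h1 h2
    have h3 := hb c h1 h2
    rw [← N_rpow p hp, ← N_rpow p hp] at h3
    rw [← rpow_le_rpow_iff (N_nonneg p _) (mul_nonneg hA'0 (N_nonneg p _)) hr0,
      mul_rpow hA'0 (N_nonneg p _), hA', ← rpow_mul hA, inv_mul_cancel₀ hr0.ne', rpow_one]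
    exact h3
  refine ⟨4 * A', by positivity, fun c => ?_⟩
  set f := M one c with hf
  have step : ∀ h : C(UnitCircle, ℝ), (∀ x, |h x| ≤ ‖f x‖) → ∀ η : ℝ, 0 < η →
      ∃ e, ‖M one e - (⟨fun x => ((max (h x) 0 : ℝ) : ℂ), by fun_prop⟩ : C(UnitCircle, ℂ))‖ ≤ η ∧
        N p (M sgn e) ≤ A' * (N p f + η) := by
    intro h hh η hη
    set g : C(UnitCircle, ℂ) := ⟨fun x => ((max (h x) 0 : ℝ) : ℂ), by fun_prop⟩ with hg
    obtain ⟨e, he1, he2, he3⟩ := exists_approx_pos g (fun x => by simp [hg]) η hη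
    refine ⟨e, he3, (hbd e he1 he2).trans ?_⟩
    gcongr
    have h1 : N p g ≤ N p f := N_mono p fun x => by
      simp only [hg, ContinuousMap.coe_mk, Complex.norm_real, norm_eq_abs]
      refine le_trans ?_ (hh x)
      rw [abs_of_nonneg (le_max_right _ _)]
      exact max_le (le_abs_self _) (abs_nonneg _)
    have h2 := N_add p (M one e - g) g
    rw [sub_add_cancel] at h2
    linarith [N_le p (M one e - g)]
  refine le_of_forall_pos_le_add fun ε hε => ?_
  set η := ε / (4 * A' + 8) with hη
  have hη0 : 0 < η := by positivity
  have hre : ∀ x, |(f x).re| ≤ ‖f x‖ := fun x => Complex.abs_re_le_norm _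
  have him : ∀ x, |(f x).im| ≤ ‖f x‖ := fun x => Complex.abs_im_le_norm _
  obtain ⟨c0, h0, k0⟩ := step ⟨fun x => (f x).re, by fun_prop⟩ (fun x => hre x) η hη0
  obtain ⟨c1, h1, k1⟩ := step ⟨fun x => -(f x).re, by fun_prop⟩ (fun x => by simpa using hre x) η hη0
  obtain ⟨c2, h2, k2⟩ := step ⟨fun x => (f x).im, by fun_prop⟩ (fun x => him x) η hη0
  obtain ⟨c3, h3, k3⟩ := step ⟨fun x => -(f x).im, by fun_prop⟩ (fun x => by simpa using him x) η hη0
  set e := c - (c0 - c1 + Complex.I • (c2 - c3)) with he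
  have hee : ‖M one e‖ ≤ 4 * η := by
    rw [ContinuousMap.norm_le _ (by positivity)]
    intro x
    have q0 := (ContinuousMap.norm_coe_le_norm _ x).trans h0
    have q1 := (ContinuousMap.norm_coe_le_norm _ x).trans h1
    have q2 := (ContinuousMap.norm_coe_le_norm _ x).trans h2
    have q3 := (ContinuousMap.norm_coe_le_norm _ x).trans h3
    simp only [ContinuousMap.sub_apply, ContinuousMap.coe_mk] at q0 q1 q2 q3
    have hmax : ∀ r : ℝ, max r 0 - max (-r) 0 = r := fun r => by
      rcases le_total 0 r with h | h
      · rw [max_eq_left h, max_eq_right (by linarith)]; ring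
      · rw [max_eq_right h, max_eq_left (by linarith)]; ring
    have hfx : f x = ((max (f x).re 0 : ℝ) : ℂ) - ((max (-(f x).re) 0 : ℝ) : ℂ) +
        Complex.I * (((max (f x).im 0 : ℝ) : ℂ) - ((max (-(f x).im) 0 : ℝ) : ℂ)) := by
      rw [← Complex.ofReal_sub, ← Complex.ofReal_sub, hmax, hmax]
      linear_combination -Complex.re_add_im (f x)
    have hexp : M one e x = -((M one c0 x - ((max (f x).re 0 : ℝ) : ℂ))
        - (M one c1 x - ((max (-(f x).re) 0 : ℝ) : ℂ)) +
        Complex.I * ((M one c2 x - ((max (f x).im 0 : ℝ) : ℂ)) -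
          (M one c3 x - ((max (-(f x).im) 0 : ℝ) : ℂ)))) := by
      rw [he]
      simp only [map_sub, map_add, map_smul, ContinuousMap.sub_apply, ContinuousMap.add_apply,
        ContinuousMap.smul_apply, smul_eq_mul, ← hf]
      linear_combination hfx
    rw [hexp, norm_neg]
    refine (norm_add_le _ _).trans ?_
    rw [norm_mul, Complex.norm_I, one_mul]
    linarith [norm_sub_le (M one c0 x - ((max (f x).re 0 : ℝ) : ℂ))
        (M one c1 x - ((max (-(f x).re) 0 : ℝ) : ℂ)),
      norm_sub_le (M one c2 x - ((max (f x).im 0 : ℝ) : ℂ))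
          (M one c3 x - ((max (-(f x).im) 0 : ℝ) : ℂ))]
  have hs := N_sgn_le p hp2 e
  have hc : M sgn c = M sgn e + (M sgn c0 - M sgn c1 + Complex.I • (M sgn c2 - M sgn c3)) := by
    rw [← map_sub, ← map_sub, ← map_smul, ← map_add, ← map_add, he, sub_add_cancel]
  rw [hc]
  have t1 := N_add p (M sgn e) (M sgn c0 - M sgn c1 + Complex.I • (M sgn c2 - M sgn c3))
  have t2 := N_add p (M sgn c0 - M sgn c1) (Complex.I • (M sgn c2 - M sgn c3))
  rw [N_smul, Complex.norm_I, one_mul] at t2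
  have t3 := N_sub p (M sgn c0) (M sgn c1)
  have t4 := N_sub p (M sgn c2) (M sgn c3)
  have t5 : (4 * A' + 8) * η = ε := by rw [hη]; field_simp
  nlinarith

def zro (k : ℤ) : ℝ := if k = 0 then 1 else 0

theorem N_pos_le (p : ℝ≥0∞) [Fact (1 ≤ p)] (c : ℤ →₀ ℂ) : N p (M pos c) ≤ N p (M sgn c) := by
  have hd : DiffContOnCl ℂ (G c) (Metric.ball 0 |1|) := (G_diff c).diffContOnCl
  have hm : c 0 = ∫ x, M sgn c x ∂circleMeasure := by
    rw [← G_zero, ← hd.circleAverage, ← integral_circle]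
    simp only [G_fourier]
  have hz : M zro c = c 0 • (fourier 0 : C(UnitCircle, ℂ)) := by
    ext x
    rw [M_apply, Finsupp.sum_eq_single 0]
    · simp [zro]
    · intro k _ hk; simp [zro, hk]
    · simp
  have h1 : N p (M zro c) ≤ N p (M sgn c) := by
    rw [hz, N_smul, hm]
    have : N p (fourier 0 : C(UnitCircle, ℂ)) ≤ 1 := (N_le p _).trans (fourier_norm 0).le
    have h2 := norm_integral_le_N p (M sgn c)
    nlinarith [norm_nonneg (∫ x, M sgn c x ∂circleMeasure), N_nonneg p (M sgn c)]
  have h2 : M pos c = (1 / 2 : ℂ) • (M sgn c + M zro c) := by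
    rw [M_add]
    ext x
    simp only [ContinuousMap.smul_apply, M_apply, Finsupp.sum, Finset.smul_sum]
    refine Finset.sum_congr rfl fun k _ => ?_
    have : pos k = 1 / 2 * (sgn k + zro k) := by
      simp only [pos, sgn, zro]; split_ifs <;> first | omega | norm_num
    rw [this, smul_eq_mul]; push_cast; ring
  rw [h2, N_smul]
  have := N_add p (M sgn c) (M zro c)
  norm_num
  linarith

theorem bound_pos_le_two (p : ℝ≥0∞) [Fact (1 ≤ p)] (hp1 : 1 < p) (hp2 : p ≤ 2) :
    ∃ C : ℝ, 0 ≤ C ∧ ∀ c, N p (M pos c) ≤ C * N p (M one c) := by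
  obtain ⟨C, hC, h⟩ := bound_sgn p hp1 hp2
  exact ⟨C, hC, fun c => (N_pos_le p c).trans (h c)⟩

theorem integral_mul_le (p q : ℝ≥0∞) [Fact (1 ≤ p)] [Fact (1 ≤ q)] [ENNReal.HolderConjugate p q]
    (f g : C(UnitCircle, ℂ)) : ‖∫ x, f x * g x ∂circleMeasure‖ ≤ N p f * N q g := by
  have h0 : ∫ x, f x * g x ∂circleMeasure = ∫ x, (f * g) x ∂circleMeasure := rfl
  rw [h0]
  refine (norm_integral_le_integral_norm _).trans ?_
  have : Fact ((1 : ℝ≥0∞) ≤ 1) := ⟨le_rfl⟩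
  rw [integral_norm_eq_lintegral_enorm (memLp 1 (f * g)).1, ← eLpNorm_one_eq_lintegral_enorm,
    N_eq, N_eq, ← ENNReal.toReal_mul]
  refine ENNReal.toReal_mono (ENNReal.mul_ne_top (memLp p f).2.ne (memLp q g).2.ne) ?_
  exact eLpNorm_smul_le_mul_eLpNorm (r := 1) (φ := f) (memLp q g).1 (memLp p f).1

theorem M_neg (c : ℤ →₀ ℂ) (x : UnitCircle) : M neg c x = conj (M pos (cstar c) x) := by
  rw [conj_M, cstar_cstar]
  have : (fun k => pos (-k)) = neg := by
    funext k; simp only [pos, neg]; split_ifs <;> first | omega | rfl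
  rw [this]

theorem integral_fourier (k : ℤ) :
    ∫ x, (fourier k x : ℂ) ∂circleMeasure = if k = 0 then 1 else 0 := by
  have := fourierCoeff_fourier (T := 2 * π) k
  have h := congrFun this 0
  simp only [fourierCoeff, neg_zero, fourier_zero, one_smul] at h
  rw [h, Pi.single_apply]
  simp [eq_comm]

theorem integral_M (s t : ℤ → ℝ) (c d : ℤ →₀ ℂ) :
    ∫ x, M s c x * M t d x ∂circleMeasure = 
      c.sum fun k v => v * ((s k : ℂ) * ((t (-k) : ℂ) * d (-k))) := by
  have hI : ∀ f : UnitCircle → ℂ, Continuous f → Integrable f circleMeasure := fun f hf =>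
    hf.integrable_of_hasCompactSupport (HasCompactSupport.of_compactSpace f)
  simp only [M_apply, Finsupp.sum, Finset.sum_mul]
  rw [integral_finsetSum _ fun k _ => hI _ (by fun_prop)]
  refine Finset.sum_congr rfl fun k _ => ?_
  simp only [Finset.mul_sum]
  rw [integral_finsetSum _ fun k _ => hI _ (by fun_prop)]
  have : ∀ l, ∫ x, c k * ((s k : ℂ) * fourier k x) * (d l * ((t l : ℂ) * fourier l x)) ∂circleMeasure
      = if l = -k then c k * ((s k : ℂ) * ((t (-k) : ℂ) * d (-k))) else 0 := by
    intro l
    have h1 : ∀ x : UnitCircle, c k * ((s k : ℂ) * fourier k x) * (d l * ((t l : ℂ) * fourier l x)) =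
        (c k * (s k : ℂ) * (d l * (t l : ℂ))) * fourier (k + l) x := fun x => by
      rw [fourier_add]; ring
    simp only [h1]
    rw [integral_const_mul, integral_fourier]
    by_cases h : l = -k
    · subst h; simp; ring
    · rw [if_neg h, if_neg (by omega), mul_zero]
  simp only [this, Finset.sum_ite_eq']
  by_cases h : d (-k) = 0
  · simp [h]
  · simp [h]

theorem duality (c d : ℤ →₀ ℂ) :
    ∫ x, M pos c x * M one d x ∂circleMeasure = ∫ x, M one c x * M neg d x ∂circleMeasure := by
  rw [integral_M, integral_M]
  refine Finset.sum_congr rfl fun k _ => ?_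
  have : neg (-k) = pos k := by simp [neg, pos]
  simp only [this, one]; simp

theorem bound_pos (p : ℝ≥0∞) [Fact (1 ≤ p)] (hp1 : 1 < p) (hp : p ≠ ∞) :
    ∃ C : ℝ, 0 ≤ C ∧ ∀ c, N p (M pos c) ≤ C * N p (M one c) := by
  rcases le_total p 2 with hp2 | hp2
  · exact bound_pos_le_two p hp1 hp2
  have hr2 : 2 ≤ p.toReal := by
    have := ENNReal.toReal_mono hp hp2; simpa using this
  set r := p.toReal with hr
  set s := r.conjExponent with hs
  have hrs : r.HolderConjugate s := Real.HolderConjugate.conjExponent (by linarith)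
  have hs1 : 1 < s := hrs.symm.lt
  have hs2 : s ≤ 2 := by
    have := hrs.inv_add_inv_eq_one
    by_contra h
    push Not at h
    have h1 : s⁻¹ < 2⁻¹ := inv_strictAnti₀ (by norm_num) h
    have h2 : r⁻¹ ≤ 2⁻¹ := inv_anti₀ (by norm_num) hr2
    linarith
  set q := ENNReal.ofReal s with hq
  have hqs : q.toReal = s := ENNReal.toReal_ofReal (by linarith)
  have hpr : p = ENNReal.ofReal r := (ENNReal.ofReal_toReal hp).symm
  have hq1 : 1 < q := by rw [hq, ← ENNReal.ofReal_one]; exact (ENNReal.ofReal_lt_ofReal_iff (by linarith)).2 hs1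
  have hq2 : q ≤ 2 := by rw [hq]; exact ENNReal.ofReal_le_of_le_toReal (by simpa using hs2)
  have hq' : q ≠ ∞ := ENNReal.ofReal_ne_top
  have : Fact (1 ≤ q) := ⟨hq1.le⟩
  have : ENNReal.HolderConjugate p q := by
    rw [hpr]; exact hrs.ennrealOfReal
  obtain ⟨C, hC, hb⟩ := bound_pos_le_two q hq1 hq2
  have hneg : ∀ d, N q (M neg d) ≤ C * N q (M one d) := by
    intro d
    have h1 : N q (M neg d) ≤ N q (M pos (cstar d)) := N_mono q fun x => by rw [M_neg]; simp
    have h2 : N q (M one (cstar d)) ≤ N q (M one d) := N_mono q fun x => by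
      have := conj_M one d x
      change _ = M one (cstar d) x at this
      rw [← this]; simp
    exact h1.trans ((hb _).trans (by gcongr))
  refine ⟨C, hC, fun c => ?_⟩
  set h := M pos c with hh
  have key : ∀ g : C(UnitCircle, ℂ),
      ‖∫ x, h x * g x ∂circleMeasure‖ ≤ C * N p (M one c) * N q g := by
    have hcl : IsClosed {g : C(UnitCircle, ℂ) |
        ‖∫ x, h x * g x ∂circleMeasure‖ ≤ C * N p (M one c) * N q g} := by
      refine isClosed_le (Continuous.norm ?_) ?_
      · have : ∀ g : C(UnitCircle, ℂ), ∫ x, h x * g x ∂circleMeasure =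
            (L1.integralCLM' ℂ) (ContinuousMap.toLp (E := ℂ) 1 circleMeasure ℂ (h * g)) := by
          intro g
          rw [← L1.integral_eq', L1.integral_eq_integral]
          exact integral_congr_ae (ContinuousMap.coeFn_toLp (𝕜 := ℂ) circleMeasure (h * g)).symm
        simp only [this]
        fun_prop
      · unfold N; fun_prop
    refine fun g => dense_M.induction_on (p := fun g => ‖∫ x, h x * g x ∂circleMeasure‖ ≤
      C * N p (M one c) * N q g) g hcl fun d => ?_
    rw [hh, duality]
    refine (integral_mul_le p q _ _).trans ?_
    have := hneg d
    nlinarith [N_nonneg p (M one c)]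
  let g : C(UnitCircle, ℂ) := ⟨fun x => ((‖h x‖ ^ (r - 2) : ℝ) : ℂ) * conj (h x), by
    have : Continuous fun x => ‖h x‖ ^ (r - 2) :=
      h.continuous.norm.rpow_const fun _ => Or.inr (by linarith)
    fun_prop⟩
  have hr0 : 0 < r := by linarith
  have hg1 : ∀ x, h x * g x = ((‖h x‖ ^ r : ℝ) : ℂ) := fun x => by
    change h x * (((‖h x‖ ^ (r - 2) : ℝ) : ℂ) * conj (h x)) = _
    have h1 : ‖h x‖ ^ r = ‖h x‖ ^ (r - 2) * ‖h x‖ ^ 2 := by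
      rw [← rpow_natCast, ← rpow_add_of_nonneg (norm_nonneg _) (by linarith) (by norm_num)]
      norm_num
    rw [h1, mul_left_comm, Complex.mul_conj']
    push_cast; ring
  have hg2 : ∀ x, ‖g x‖ ^ s = ‖h x‖ ^ r := fun x => by
    change ‖((‖h x‖ ^ (r - 2) : ℝ) : ℂ) * conj (h x)‖ ^ s = _
    rw [norm_mul, RCLike.norm_conj, Complex.norm_real, norm_eq_abs, abs_of_nonneg (by positivity)]
    have h1 : ‖h x‖ ^ (r - 2) * ‖h x‖ = ‖h x‖ ^ (r - 1) := by
      nth_rewrite 2 [← rpow_one ‖h x‖]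
      rw [← rpow_add_of_nonneg (norm_nonneg _) (by linarith) (by norm_num)]
      congr 1; ring
    rw [h1, ← rpow_mul (norm_nonneg _), hrs.sub_one_mul_conj]
  have e1 : ‖∫ x, h x * g x ∂circleMeasure‖ = N p h ^ r := by
    simp only [hg1]
    rw [integral_complex_ofReal, Complex.norm_real, N_rpow p hp, norm_eq_abs, abs_of_nonneg]
    exact integral_nonneg fun x => by positivity
  have e2 : N q g ^ s = N p h ^ r := by
    have := N_rpow q hq' g
    rw [hqs] at this
    rw [this, N_rpow p hp]
    simp only [hg2]; rfl
  have e3 : N q g = N p h ^ (r - 1) := by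
    have h1 : N q g = (N q g ^ s) ^ s⁻¹ := by
      rw [← rpow_mul (N_nonneg q g), mul_inv_cancel₀ (by linarith), rpow_one]
    rw [h1, e2, ← rpow_mul (N_nonneg p h)]
    congr 1
    rw [mul_inv_eq_iff_eq_mul₀ (by linarith)]
    exact hrs.sub_one_mul_conj.symm
  have fin := key g
  rw [e1, e3] at fin
  rcases (N_nonneg p h).eq_or_lt with h0 | h0
  · rw [← h0]; exact mul_nonneg hC (N_nonneg p _)
  · have h1 : N p h ^ r = N p h * N p h ^ (r - 1) := by
      nth_rewrite 2 [← rpow_one (N p h)]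
      rw [← rpow_add h0]; congr 1; ring
    rw [h1] at fin
    exact le_of_mul_le_mul_right fin (by positivity)

theorem continuous_coeff (p : ℝ≥0∞) [Fact (1 ≤ p)] (k : ℤ) :
    Continuous fun f : Lp ℂ p circleMeasure => fourierCoeff f k := by
  have hI : ∀ f : Lp ℂ p circleMeasure, Integrable f circleMeasure :=
    fun f => (Lp.memLp f).integrable Fact.out
  refine (LipschitzWith.of_dist_le_mul (K := 1) fun f g => ?_).continuous
  rw [dist_eq_norm, dist_eq_norm, NNReal.coe_one, one_mul]
  have h1 : fourierCoeff f k - fourierCoeff g k = fourierCoeff (f - g : Lp ℂ p circleMeasure) k := by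
    rw [fourierCoeff_congr_ae (Lp.coeFn_sub f g), fourierCoeff, fourierCoeff, fourierCoeff,
      ← integral_sub ((hI f).fourier_smul _) ((hI g).fourier_smul _)]
    simp only [Pi.sub_apply, smul_sub]
  rw [h1, fourierCoeff]
  refine (norm_integral_le_integral_norm _).trans ?_
  have h2 : ∀ x, ‖(fourier (-k) x : ℂ) • (f - g : Lp ℂ p circleMeasure) x‖ =
      ‖(f - g : Lp ℂ p circleMeasure) x‖ := fun x => by
    rw [norm_smul, fourier_apply, Circle.norm_coe, one_mul]
  simp only [h2]
  rw [integral_norm_eq_lintegral_enorm (Lp.aestronglyMeasurable _),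
    ← eLpNorm_one_eq_lintegral_enorm, Lp.norm_def]
  exact ENNReal.toReal_mono (Lp.memLp _).2.ne
    (eLpNorm_le_eLpNorm_of_exponent_le Fact.out (Lp.aestronglyMeasurable _))

theorem coeff_M (p : ℝ≥0∞) [Fact (1 ≤ p)] (s : ℤ → ℝ) (c : ℤ →₀ ℂ) (k : ℤ) :
    fourierCoeff (ContinuousMap.toLp (E := ℂ) p circleMeasure ℂ (M s c)) k = (s k : ℂ) * c k := by
  rw [fourierCoeff_congr_ae (ContinuousMap.coeFn_toLp (𝕜 := ℂ) circleMeasure (M s c))]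
  have h := integral_M s one c (Finsupp.single (-k) 1)
  have h1 : ∀ x, M one (Finsupp.single (-k) 1) x = fourier (-k) x := fun x => by
    rw [M_apply, Finsupp.sum_single_index] <;> simp [one]
  simp only [h1] at h
  rw [fourierCoeff]
  simp only [smul_eq_mul, mul_comm (fourier (-k) _ : ℂ), h]
  rw [Finsupp.sum_eq_single k]
  · simp [one]; ring
  · intro l _ hl
    rw [Finsupp.single_apply, if_neg (by omega)]; simp
  · simp

theorem exists_projection (p : ℝ≥0∞) [Fact (1 ≤ p)] (hp1 : 1 < p) (hp : p ≠ ∞) :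
    ∃ P : Lp ℂ p circleMeasure →L[ℂ] Lp ℂ p circleMeasure,
      ∀ (f : Lp ℂ p circleMeasure) (k : ℤ),
        fourierCoeff (P f) k = if 0 ≤ k then fourierCoeff f k else 0 := by
  obtain ⟨C, hC, hb⟩ := bound_pos p hp1 hp
  let T := ContinuousMap.toLp (E := ℂ) p circleMeasure ℂ
  let e : (ℤ →₀ ℂ) →ₗ[ℂ] Lp ℂ p circleMeasure := T.toLinearMap ∘ₗ M one
  let e' : (ℤ →₀ ℂ) →ₗ[ℂ] Lp ℂ p circleMeasure := T.toLinearMap ∘ₗ M pos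
  have hd : DenseRange e := by
    have h1 : DenseRange T := ContinuousMap.toLp_denseRange ℂ circleMeasure ℂ hp
    exact h1.comp dense_M T.continuous
  have hbd : ∀ c, ‖e' c‖ ≤ C * ‖e c‖ := hb
  let P := e'.extendOfNorm e
  have hP : ∀ c, P (e c) = e' c := LinearMap.extendOfNorm_eq hd ⟨C, hbd⟩
  refine ⟨P, fun f k => ?_⟩
  have hcont := continuous_coeff p k
  refine hd.induction_on (p := fun f : Lp ℂ p circleMeasure =>
    fourierCoeff (P f) k = if 0 ≤ k then fourierCoeff f k else 0) f ?_ fun c => ?_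
  · refine isClosed_eq (hcont.comp P.continuous) ?_
    split_ifs
    · exact hcont
    · exact continuous_const
  · rw [hP]
    have h1 := coeff_M p pos c k
    have h2 := coeff_M p one c k
    change fourierCoeff (T (M pos c)) k = _ at h1
    change fourierCoeff (T (M one c)) k = _ at h2
    change fourierCoeff (T (M pos c)) k = if 0 ≤ k then fourierCoeff (T (M one c)) k else 0
    rw [h1, h2]
    simp only [pos, one]
    split_ifs <;> simp
end Riesz

end RieszTheorem

/-- `f ∈ H^r(𝕋)`, for a function `f`: `f ∈ L^r(𝕋)` and `f_k = 0` for all `k < 0`. -/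
def IsHardy (r : ℝ≥0∞) (f : UnitCircle → ℂ) : Prop :=
  MemLp f r circleMeasure ∧ ∀ k : ℤ, k < 0 → fourierCoeff f k = 0

/-- The Hardy space `H^p(𝕋)` as a subspace of `L^p(𝕋)`, with the norm of `L^p(𝕋)`. -/
def hardySpace (p : ℝ≥0∞) [Fact (1 ≤ p)] : Submodule ℂ (Lp ℂ p circleMeasure) where
  carrier := {f | IsHardy p f}
  zero_mem' := by
    refine ⟨Lp.memLp _, fun k _ => ?_⟩
    rw [fourierCoeff_congr_ae (Lp.coeFn_zero ℂ p circleMeasure)]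
    simp [fourierCoeff]
  add_mem' := by
    rintro f g ⟨_, hf⟩ ⟨_, hg⟩
    refine ⟨Lp.memLp _, fun k hk => ?_⟩
    rw [fourierCoeff_congr_ae (Lp.coeFn_add f g),
      fourierCoeff.add ((Lp.memLp f).integrable Fact.out) ((Lp.memLp g).integrable Fact.out)]
    simp [hf k hk, hg k hk]
  smul_mem' := by
    rintro z f ⟨_, hf⟩
    refine ⟨Lp.memLp _, fun k hk => ?_⟩
    rw [fourierCoeff_congr_ae (Lp.coeFn_smul z f), fourierCoeff.const_smul, hf k hk, smul_zero]

/-- The Riesz projection `P` on `L^p(𝕋)`, `1 < p < ∞`; an element of `L^p(𝕋)` is determined by its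
Fourier coefficients, so this is the only bounded operator with the property stated next. -/
def rieszProjection (p : ℝ≥0∞) [Fact (1 ≤ p)] (hp1 : 1 < p) (hp : p ≠ ∞) :
    Lp ℂ p circleMeasure →L[ℂ] Lp ℂ p circleMeasure :=
  (Riesz.exists_projection p hp1 hp).choose

theorem fourierCoeff_rieszProjection (p : ℝ≥0∞) [Fact (1 ≤ p)] (hp1 : 1 < p) (hp : p ≠ ∞)
    (f : Lp ℂ p circleMeasure) (k : ℤ) :
    fourierCoeff (rieszProjection p hp1 hp f) k = if 0 ≤ k then fourierCoeff f k else 0 :=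
  (Riesz.exists_projection p hp1 hp).choose_spec f k

theorem rieszProjection_mem (p : ℝ≥0∞) [Fact (1 ≤ p)] (hp1 : 1 < p) (hp : p ≠ ∞)
    (f : Lp ℂ p circleMeasure) : rieszProjection p hp1 hp f ∈ hardySpace p :=
  ⟨Lp.memLp _, fun k hk => by
    rw [fourierCoeff_rieszProjection p hp1 hp, if_neg (not_le.2 hk)]⟩

/-- `L(a) : f ↦ a f` on `L^p`, for `a ∈ L^∞`. -/
def mulOp (p : ℝ≥0∞) [Fact (1 ≤ p)] (a : Lp ℂ ∞ circleMeasure) :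
    Lp ℂ p circleMeasure →L[ℂ] Lp ℂ p circleMeasure :=
  (ContinuousLinearMap.mul ℂ ℂ).holderL circleMeasure ∞ p p a

/-- `f̃(t) = f(t⁻¹)` -/
def tilde (f : UnitCircle → ℂ) : UnitCircle → ℂ := fun x => f (-x)

theorem measurePreserving_neg_circle :
    MeasurePreserving (fun x : UnitCircle => -x) circleMeasure circleMeasure :=
  Measure.measurePreserving_neg _

/-- `f ↦ f̃` on `L^p(𝕋)`. -/
def tildeOp (p : ℝ≥0∞) [Fact (1 ≤ p)] : Lp ℂ p circleMeasure →L[ℂ] Lp ℂ p circleMeasure :=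
  (Lp.compMeasurePreservingₗᵢ ℂ (fun x : UnitCircle => -x)
    measurePreserving_neg_circle).toContinuousLinearMap

/-- The flip `J : f(t) ↦ t⁻¹ f(t⁻¹)` on `L^p(𝕋)`. -/
def flipOp (p : ℝ≥0∞) [Fact (1 ≤ p)] : Lp ℂ p circleMeasure →L[ℂ] Lp ℂ p circleMeasure :=
  (mulOp p (fourierLp ∞ (-1))).comp (tildeOp p)

/-- The Toeplitz operator `T(a) = P L(a) P` restricted to `H^p(𝕋)`. -/
def toeplitz (p : ℝ≥0∞) [Fact (1 ≤ p)] (hp1 : 1 < p) (hp : p ≠ ∞) (a : Lp ℂ ∞ circleMeasure) :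
    hardySpace p →L[ℂ] hardySpace p :=
  ((rieszProjection p hp1 hp).comp ((mulOp p a).comp (hardySpace p).subtypeL)).codRestrict
    (hardySpace p) fun _ => rieszProjection_mem p hp1 hp _

/-- The Hankel operator `H(a) = P L(a) J P` restricted to `H^p(𝕋)`. -/
def hankel (p : ℝ≥0∞) [Fact (1 ≤ p)] (hp1 : 1 < p) (hp : p ≠ ∞) (a : Lp ℂ ∞ circleMeasure) :
    hardySpace p →L[ℂ] hardySpace p :=
  ((rieszProjection p hp1 hp).comp
    ((mulOp p a).comp ((flipOp p).comp (hardySpace p).subtypeL))).codRestrict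
    (hardySpace p) fun _ => rieszProjection_mem p hp1 hp _

/-- `a ∈ GL^∞(𝕋)`: `a` is invertible in `L^∞(𝕋)`. -/
def IsInvertibleLinfty (a : Lp ℂ ∞ circleMeasure) : Prop :=
  ∃ a' : Lp ℂ ∞ circleMeasure, ∀ᵐ x ∂circleMeasure, a x * a' x = 1

/-- `c(t) = c₊(t) t^{2k} c₊⁻¹(t⁻¹)` with `(1+t) c₊ ∈ H^r(𝕋)` and `(1-t) c₊⁻¹ ∈ H^s(𝕋)`. -/
structure IsAntisymmFactor (r s : ℝ≥0∞) (c cp : UnitCircle → ℂ) (k : ℤ) : Prop where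
  eq : ∀ᵐ x ∂circleMeasure, c x = cp x * fourier (2 * k) x * (tilde cp x)⁻¹
  hardy : IsHardy r fun x => (1 + fourier 1 x) * cp x
  hardy_inv : IsHardy s fun x => (1 - fourier 1 x) * (cp x)⁻¹

/-- The basic factorization conditions in `H^p(𝕋)`, where `1/p + 1/q = 1`: `a, b ∈ GL^∞(𝕋)`,
`a ã = b b̃`, `c = a/b (= b̃/ã)`, `d = ã/b (= b̃/a)`, and `c`, `d` have antisymmetric factorizations with
indices `n`, `m` and factors `cp = c₊`, `dp = d₊`. -/
structure BasicFactorization (p q : ℝ≥0∞) (a b : Lp ℂ ∞ circleMeasure) (c d : UnitCircle → ℂ)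
    (cp dp : UnitCircle → ℂ) (n m : ℤ) : Prop where
  inv_a : IsInvertibleLinfty a
  inv_b : IsInvertibleLinfty b
  tilde_eq : ∀ᵐ x ∂circleMeasure, a x * tilde a x = b x * tilde b x
  c_eq : ∀ᵐ x ∂circleMeasure, c x = a x / b x
  d_eq : ∀ᵐ x ∂circleMeasure, d x = tilde a x / b x
  c_fac : IsAntisymmFactor q p c cp n
  d_fac : IsAntisymmFactor p q d dp m

/-- `ρ = t^{-m-n} (1+t) (1+t⁻¹) c̃₊ d̃₊ b⁻¹`. -/
def rho (b : Lp ℂ ∞ circleMeasure) (cp dp : UnitCircle → ℂ) (n m : ℤ) : UnitCircle → ℂ :=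
  fun x => fourier (-m - n) x * (1 + fourier 1 x) * (1 + fourier (-1) x) *
    tilde cp x * tilde dp x * (b x)⁻¹

/-- The `n × m` matrix `[ρ_{i-j} + ρ_{i+j}]`, `0 ≤ i < n`, `0 ≤ j < m`. -/
def toeplitzHankelMatrix (ρ : UnitCircle → ℂ) (n m : ℕ) : Matrix (Fin n) (Fin m) ℂ :=
  Matrix.of fun i j => fourierCoeff ρ ((i : ℤ) - (j : ℤ)) + fourierCoeff ρ ((i : ℤ) + (j : ℤ))

/-- The Banach space adjoint `A^* : X' → X'`, `φ ↦ φ ∘ A`. -/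
def banachAdjoint {X : Type*} [NormedAddCommGroup X] [NormedSpace ℂ X] (A : X →L[ℂ] X) :
    StrongDual ℂ X →L[ℂ] StrongDual ℂ X := ContinuousLinearMap.precomp ℂ A

/-- The Fredholm index `dim ker A - dim (X / im A)`. -/
def fredholmIndex {X : Type*} [NormedAddCommGroup X] [NormedSpace ℂ X] (A : X →L[ℂ] X) : ℤ :=
  (Module.finrank ℂ (LinearMap.ker A.toLinearMap) : ℤ) -
    (Module.finrank ℂ (X ⧸ LinearMap.range A.toLinearMap) : ℤ)

end

/-! Write `L(a) f = a f`, so that `T(a) + H(b) = P (L(a) + L(b) J)` on `H^p`. A function `f ∈ H^p` is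
in the kernel exactly if `h = J (a f + b J f)` is in `H^p`, since `ker P = J H^p`. From
`a ã = b b̃` one computes that every such `h` satisfies `h = d · J h`, and that `a f + b J f = 0`
means `f = -c⁻¹ · J f`. Hence `f ↦ h` maps the kernel to the eigenspace `{h ∈ H^p : h = d · J h}`
(`flipEigenspace`), with kernel the eigenspace of `-c⁻¹`.

The eigenspaces can be written down (`range_eigenMap`, `finrank_flipEigenspace`). Suppose that
`d = d₊ t^{2m} d̃₊⁻¹`. If `h = d · J h`, then `v = (1-t) d₊⁻¹ h` is in `H^1` and satisfies
`v = -t^{2m} ṽ`, that is `v_k = -v_{2m-k}`, so that `v` is determined by `v_{m+1}, …, v_{2m}`. The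
dimension is therefore at most `max m 0`. On the other hand, the functions
`(1+t) d₊ t^{m-1} ∑_{j<m} x_j (t^j + t^{-j})` are solutions and form a space of this dimension.
The function `-c⁻¹` has a factorization of the same kind with index `-n` (`neg_inv_fac`), which
gives the summand `max (-n) 0`.

It remains to decide which `h` with `h = d · J h` occur (`exists_flipOp_mulAddFlip_eq_iff`). As
`T(a) + H(b)` is Fredholm, the range of `L(a) + L(b) J` on `H^p` is closed, so `h` occurs if and
only if `J h` is annihilated by all functionals that vanish on this range. By `(L^p)' = L^q`
(`exists_memLp_forall_eq_integral`) these are given by functions `g ∈ L^q`, and then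
`w = J (ã g + b J g)` is a solution of `w = c · J w` in `H^q`. The value of the functional at
`J h` is half the integral of `h̃ w a⁻¹`, and in the coordinates of the two eigenspaces this is
the bilinear form of the matrix `[ρ_{i-j} + ρ_{i+j}]` (`integral_eigenMap_mul_eigenMap`). So
`dim ker (T(a) + H(b)) = max (-n) 0 + dim ker A_{n,m}` (`BasicFactorization.finrank_ker`), where
`A_{n,m}` is an empty matrix if `n ≤ 0` or `m ≤ 0`.

Under the pairing `∑ f_k g_k` the dual of `H^p` is `H^q` and the adjoint of `T(a) + H(b)` is
`T(ã) + H(b)` on `H^q`, whose data are those of `T(a) + H(b)` with `p, a, c, n` and `q, ã, d, m`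
exchanged. This gives the second formula, with `A_{n,m}` replaced by its transpose because `ρ` is
even, and the index follows from the equality of row rank and column rank. -/

/-! ### The dual of `L^p` -/

section LpDual

open Filter Topology Set

theorem toReal_eLpNorm_rpow {α : Type*} [MeasurableSpace α] {μ : Measure α} {p : ℝ≥0∞}
    (hp0 : p ≠ 0) (hp : p ≠ ∞) {f : α → ℂ} (hf : MemLp f p μ) :
    (eLpNorm f p μ).toReal ^ p.toReal = ∫ x, ‖f x‖ ^ p.toReal ∂μ := by
  have h0 : 0 ≤ ∫ x, ‖f x‖ ^ p.toReal ∂μ := integral_nonneg fun x => by positivity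
  rw [hf.eLpNorm_eq_integral_rpow_norm hp0 hp, ENNReal.toReal_ofReal (by positivity),
    ← Real.rpow_mul h0, inv_mul_cancel₀ (ENNReal.toReal_pos hp0 hp).ne', Real.rpow_one]

variable {α : Type*} [MeasurableSpace α] {μ : Measure α} [IsFiniteMeasure μ] {p q : ℝ≥0∞}

theorem sum_indicatorConstLp {f : ℕ → Set α} (hf : ∀ i, MeasurableSet (f i))
    (hd : Pairwise (Function.onFun Disjoint f)) (S : Finset ℕ) :
    ∑ i ∈ S, indicatorConstLp p (hf i) (measure_ne_top μ _) (1 : ℂ) =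
      indicatorConstLp p (S.measurableSet_biUnion fun i _ => hf i) (measure_ne_top μ _)
        (1 : ℂ) := by
  classical
  induction S using Finset.induction_on with
  | empty => simp
  | insert i S hi ih =>
    rw [Finset.sum_insert hi, ih, ← indicatorConstLp_disjoint_union]
    · congr 1; simp
    · rw [Set.disjoint_iUnion₂_right]
      exact fun j hj => hd fun h => hi (h ▸ hj)

variable [Fact (1 ≤ p)]

theorem hasSum_indicatorConstLp (hp : p ≠ ∞) {f : ℕ → Set α} (hf : ∀ i, MeasurableSet (f i))
    (hd : Pairwise (Function.onFun Disjoint f)) :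
    HasSum (fun i => indicatorConstLp p (hf i) (measure_ne_top μ _) (1 : ℂ))
      (indicatorConstLp p (MeasurableSet.iUnion hf) (measure_ne_top μ _) (1 : ℂ)) := by
  rw [HasSum, SummationFilter.unconditional_filter]
  simp only [sum_indicatorConstLp hf hd]
  refine tendsto_indicatorConstLp_set hp ?_
  have hsub : ∀ S : Finset ℕ, (⋃ i ∈ S, f i) ⊆ ⋃ i, f i := fun S =>
    iUnion₂_subset fun i _ => subset_iUnion f i
  have h0 : μ (⋂ S : Finset ℕ, (⋃ i, f i) \ ⋃ i ∈ S, f i) = 0 := by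
    have : (⋂ S : Finset ℕ, (⋃ i, f i) \ ⋃ i ∈ S, f i) = ∅ := by
      ext x
      simp only [mem_iInter, Set.mem_sdiff, mem_iUnion, mem_empty_iff_false, iff_false, not_forall]
      by_cases hx : ∃ i, x ∈ f i
      · obtain ⟨i, hi⟩ := hx
        exact ⟨{i}, fun h => h.2 ⟨i, by simp, hi⟩⟩
      · exact ⟨∅, fun h => hx h.1⟩
    rw [this, measure_empty]
  have h1 := tendsto_measure_iInter_atTop (μ := μ)
    (s := fun S : Finset ℕ => (⋃ i, f i) \ ⋃ i ∈ S, f i)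
    (fun S => ((MeasurableSet.iUnion hf).diff
      (S.measurableSet_biUnion fun i _ => hf i)).nullMeasurableSet)
    (fun S T hST => sdiff_subset_sdiff_right (biUnion_subset_biUnion_left hST))
    ⟨∅, measure_ne_top μ _⟩
  rw [h0] at h1
  refine h1.congr fun S => congrArg μ ?_
  rw [symmDiff_def, sdiff_eq_bot_iff.2 (hsub S), bot_sup_eq]

open Classical in
/-- The signed measure `E ↦ L(1_E)` attached to a real functional `L` on `L^p`. -/
noncomputable def functionalMeasure (hp : p ≠ ∞) (L : Lp ℂ p μ →L[ℝ] ℝ) : SignedMeasure α where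
  measureOf' E := if h : MeasurableSet E then
    L (indicatorConstLp p h (measure_ne_top μ _) (1 : ℂ)) else 0
  empty' := by simp
  not_measurable' E h := by simp [h]
  m_iUnion' f hf hd := by
    simp only [hf, MeasurableSet.iUnion hf, dif_pos]
    exact L.hasSum (hasSum_indicatorConstLp hp hf hd)

theorem functionalMeasure_apply (hp : p ≠ ∞) (L : Lp ℂ p μ →L[ℝ] ℝ) {E : Set α}
    (hE : MeasurableSet E) : functionalMeasure hp L E =
      L (indicatorConstLp p hE (measure_ne_top μ _) (1 : ℂ)) := dif_pos hE

theorem exists_real_density (hp : p ≠ ∞) (L : Lp ℂ p μ →L[ℝ] ℝ) :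
    ∃ g : α → ℝ, Integrable g μ ∧ ∀ (E : Set α) (hE : MeasurableSet E),
      L (indicatorConstLp p hE (measure_ne_top μ _) (1 : ℂ)) = ∫ x in E, g x ∂μ := by
  have hac : functionalMeasure hp L ≪ᵥ μ.toENNRealVectorMeasure := by
    refine VectorMeasure.AbsolutelyContinuous.mk fun E hE h0 => ?_
    rw [Measure.toENNRealVectorMeasure_apply_measurable hE] at h0
    have : indicatorConstLp p hE (measure_ne_top μ _) (1 : ℂ) = 0 := by
      rw [← norm_eq_zero, norm_indicatorConstLp (zero_lt_one.trans_le Fact.out).ne' hp]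
      have : 0 < p.toReal := ENNReal.toReal_pos (zero_lt_one.trans_le Fact.out).ne' hp
      simp [Measure.real, h0, this.ne']
    rw [functionalMeasure_apply hp L hE, this, map_zero]
  refine ⟨(functionalMeasure hp L).rnDeriv μ, SignedMeasure.integrable_rnDeriv _ _,
    fun E hE => ?_⟩
  have h := SignedMeasure.withDensityᵥ_rnDeriv_eq _ μ hac
  rw [← withDensityᵥ_apply (SignedMeasure.integrable_rnDeriv _ _) hE, h,
    functionalMeasure_apply hp L hE]

theorem exists_density (hp : p ≠ ∞) (L : StrongDual ℂ (Lp ℂ p μ)) :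
    ∃ g : α → ℂ, Integrable g μ ∧ ∀ (E : Set α) (hE : MeasurableSet E),
      L (indicatorConstLp p hE (measure_ne_top μ _) (1 : ℂ)) = ∫ x in E, g x ∂μ := by
  obtain ⟨u, hu, hu'⟩ := exists_real_density hp (Complex.reCLM.comp (L.restrictScalars ℝ))
  obtain ⟨v, hv, hv'⟩ := exists_real_density hp (Complex.imCLM.comp (L.restrictScalars ℝ))
  refine ⟨fun x => (u x : ℂ) + (v x : ℂ) * Complex.I, hu.ofReal.add (hv.ofReal.mul_const _),
    fun E hE => ?_⟩
  have h1 : Integrable (fun x => (u x : ℂ)) (μ.restrict E) := hu.ofReal.integrableOn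
  have h2 : Integrable (fun x => (v x : ℂ) * Complex.I) (μ.restrict E) :=
    (hv.ofReal.mul_const _).integrableOn
  rw [integral_add h1 h2, integral_mul_const, integral_complex_ofReal, integral_complex_ofReal,
    ← hu' E hE, ← hv' E hE]
  exact (Complex.re_add_im _).symm

/-- The representation extends from indicators to bounded functions, by dominated convergence along
simple approximations. -/
theorem functional_eq_integral_of_bounded (hp : p ≠ ∞) (L : StrongDual ℂ (Lp ℂ p μ)) {g : α → ℂ}
    (hg : Integrable g μ)
    (hL : ∀ (E : Set α) (hE : MeasurableSet E),
      L (indicatorConstLp p hE (measure_ne_top μ _) (1 : ℂ)) = ∫ x in E, g x ∂μ)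
    {f : α → ℂ} (hf : Measurable f) {C : ℝ} (hC : ∀ x, ‖f x‖ ≤ C) (hfp : MemLp f p μ) :
    L (hfp.toLp f) = ∫ x, f x * g x ∂μ := by
  have hbdd : ∀ s : SimpleFunc α ℂ, Integrable (fun x => s x * g x) μ := fun s => by
    obtain ⟨C, hC⟩ := s.exists_forall_norm_le
    exact hg.bdd_mul s.stronglyMeasurable.aestronglyMeasurable (Eventually.of_forall hC)
  have hs : ∀ s : SimpleFunc α ℂ, L ((s.memLp_of_isFiniteMeasure p μ).toLp s) =
      ∫ x, s x * g x ∂μ := by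
    intro s
    induction s using SimpleFunc.induction with
    | const c hE =>
      rename_i E
      have h1 : MemLp.toLp _ ((SimpleFunc.piecewise E hE (SimpleFunc.const α c)
          (SimpleFunc.const α 0)).memLp_of_isFiniteMeasure p μ) =
          c • indicatorConstLp p hE (measure_ne_top μ _) (1 : ℂ) := by
        refine Lp.ext ?_
        filter_upwards [MemLp.coeFn_toLp ((SimpleFunc.piecewise E hE (SimpleFunc.const α c)
          (SimpleFunc.const α 0)).memLp_of_isFiniteMeasure p μ),
          Lp.coeFn_smul c (indicatorConstLp p hE (measure_ne_top μ _) (1 : ℂ)),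
          indicatorConstLp_coeFn (p := p) (hs := hE) (hμs := measure_ne_top μ _) (c := (1 : ℂ))]
          with x h1 h2 h3
        rw [h1, h2, Pi.smul_apply, h3]
        by_cases hx : x ∈ E <;> simp [hx]
      rw [h1, map_smul, hL, smul_eq_mul, ← integral_const_mul, ← integral_indicator hE]
      refine integral_congr_ae (Eventually.of_forall fun x => ?_)
      by_cases hx : x ∈ E <;> simp [hx]
    | @add s t _ h1 h2 =>
      have : MemLp.toLp _ ((s + t).memLp_of_isFiniteMeasure p μ) =
          MemLp.toLp _ (s.memLp_of_isFiniteMeasure p μ) +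
          MemLp.toLp _ (t.memLp_of_isFiniteMeasure p μ) := rfl
      rw [this, map_add, h1, h2, ← integral_add (hbdd s) (hbdd t)]
      refine integral_congr_ae (Eventually.of_forall fun x => ?_)
      simp [add_mul]
  have h1 : Tendsto (fun n => L (((SimpleFunc.approxOn f hf univ 0 (mem_univ 0)
      n).memLp_of_isFiniteMeasure p μ).toLp _)) atTop (𝓝 (L (hfp.toLp f))) := by
    refine (L.continuous.tendsto _).comp ?_
    rw [Lp.tendsto_Lp_iff_tendsto_eLpNorm'']
    refine SimpleFunc.tendsto_approxOn_Lp_eLpNorm hf (mem_univ 0) hp (by simp) ?_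
    simpa using hfp.2
  have h2 : Tendsto (fun n => ∫ x, SimpleFunc.approxOn f hf univ 0 (mem_univ 0) n x * g x ∂μ) atTop
      (𝓝 (∫ x, f x * g x ∂μ)) := by
    refine tendsto_integral_of_dominated_convergence (fun x => (C + C) * ‖g x‖)
      (fun n => (hbdd _).1) (hg.norm.const_mul _) (fun n => Eventually.of_forall fun x => ?_)
      (Eventually.of_forall fun x => ?_)
    · rw [norm_mul]
      gcongr
      exact (SimpleFunc.norm_approxOn_zero_le hf (mem_univ 0) x n).trans (by gcongr <;> exact hC x)
    · exact (SimpleFunc.tendsto_approxOn hf (mem_univ 0) (by simp)).mul_const _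
  simp only [hs] at h1
  exact tendsto_nhds_unique h1 h2

/-- The density of a bounded functional on `L^p` is in `L^q`: test the functional against
`|g|^(q-2) conj g` cut off to the set where `|g| ≤ n`. -/
theorem memLp_density (hp1 : 1 < p) (hp : p ≠ ∞) (hpq : p.HolderConjugate q)
    (L : StrongDual ℂ (Lp ℂ p μ)) {g : α → ℂ} (hgm : Measurable g) (hg : Integrable g μ)
    (hL : ∀ (E : Set α) (hE : MeasurableSet E),
      L (indicatorConstLp p hE (measure_ne_top μ _) (1 : ℂ)) = ∫ x in E, g x ∂μ) :
    MemLp g q μ := by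
  have hr1 : 1 < p.toReal := by
    rw [← ENNReal.toReal_one]; exact (ENNReal.toReal_lt_toReal (by simp) hp).2 hp1
  have hrs := ENNReal.HolderConjugate.toReal (q := q) hr1
  have hs1 : 1 < q.toReal := hrs.symm.lt
  have hq0 : q ≠ 0 := by rintro rfl; simp at hs1; linarith
  have hq : q ≠ ∞ := by rintro rfl; simp at hs1; linarith
  set r := p.toReal with hr
  set s := q.toReal with hs
  have hEm : ∀ n : ℕ, MeasurableSet {x | ‖g x‖ ≤ n} := fun n =>
    measurableSet_le hgm.norm measurable_const
  let G : ℕ → α → ℂ := fun n => {x | ‖g x‖ ≤ n}.indicator g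
  have hGm : ∀ n, Measurable (G n) := fun n => hgm.indicator (hEm n)
  have hGb : ∀ n x, ‖G n x‖ ≤ n := fun n x => by
    by_cases hx : ‖g x‖ ≤ n
    · have : G n x = g x := indicator_of_mem (s := {x | ‖g x‖ ≤ n}) hx g
      rwa [this]
    · have : G n x = 0 := indicator_of_notMem (s := {x | ‖g x‖ ≤ n}) hx g
      simp [this]
  have hGq : ∀ n, MemLp (G n) q μ := fun n =>
    MemLp.of_bound (hGm n).aestronglyMeasurable n (Eventually.of_forall (hGb n))
  have key : ∀ n, (eLpNorm (G n) q μ).toReal ≤ ‖L‖ := by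
    intro n
    let f : α → ℂ := fun x => ((‖G n x‖ ^ (s - 2) : ℝ) : ℂ) * (starRingEnd ℂ) (G n x)
    have hfm : Measurable f :=
      (Complex.measurable_ofReal.comp ((hGm n).norm.pow_const _)).mul
        (Complex.continuous_conj.measurable.comp (hGm n))
    have hfn : ∀ x, ‖f x‖ = ‖G n x‖ ^ (s - 1) := fun x => by
      simp only [f, norm_mul, RCLike.norm_conj, Complex.norm_real, Real.norm_eq_abs]
      rw [abs_of_nonneg (by positivity)]
      rcases (norm_nonneg (G n x)).eq_or_lt with h | h
      · rw [← h, mul_zero, Real.zero_rpow (by linarith)]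
      · nth_rewrite 2 [← Real.rpow_one ‖G n x‖]
        rw [← Real.rpow_add h]; congr 1; ring
    have hfb : ∀ x, ‖f x‖ ≤ (n : ℝ) ^ (s - 1) := fun x => by
      rw [hfn]; exact Real.rpow_le_rpow (norm_nonneg _) (hGb n x) (by linarith)
    have hfp : MemLp f p μ :=
      MemLp.of_bound hfm.aestronglyMeasurable _ (Eventually.of_forall hfb)
    have hfg : ∀ x, f x * g x = ((‖G n x‖ ^ s : ℝ) : ℂ) := fun x => by
      by_cases hx : ‖g x‖ ≤ n
      · have h1 : G n x = g x := indicator_of_mem (s := {x | ‖g x‖ ≤ n}) hx g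
        simp only [f]
        rw [h1, mul_assoc, Complex.conj_mul']
        rcases (norm_nonneg (g x)).eq_or_lt with h | h
        · rw [← h, Real.zero_rpow (show s ≠ 0 by linarith)]; simp
        · rw [← Complex.ofReal_pow, ← Complex.ofReal_mul, ← Real.rpow_natCast ‖g x‖ 2,
            ← Real.rpow_add h]
          norm_num
      · have h1 : G n x = 0 := indicator_of_notMem (s := {x | ‖g x‖ ≤ n}) hx g
        simp only [f]
        rw [h1, norm_zero, Real.zero_rpow (show s ≠ 0 by linarith)]
        simp
    have h1 := functional_eq_integral_of_bounded hp L hg hL hfm hfb hfp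
    simp only [hfg] at h1
    rw [integral_complex_ofReal, ← toReal_eLpNorm_rpow hq0 hq (hGq n)] at h1
    have h2 := L.le_opNorm (hfp.toLp f)
    have h3 : ‖hfp.toLp f‖ ^ r = (eLpNorm (G n) q μ).toReal ^ s := by
      rw [Lp.norm_toLp, toReal_eLpNorm_rpow (zero_lt_one.trans hp1).ne' hp hfp,
        toReal_eLpNorm_rpow hq0 hq (hGq n)]
      refine integral_congr_ae (Eventually.of_forall fun x => ?_)
      simp only [hfn]
      rw [← Real.rpow_mul (norm_nonneg _), hrs.symm.sub_one_mul_conj]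
    set N := (eLpNorm (G n) q μ).toReal with hN
    have hN0 : 0 ≤ N := ENNReal.toReal_nonneg
    -- `|f|^p = |G n|^q = f g`, so `|L f| ≤ ‖L‖ ‖f‖` reads `N^s ≤ ‖L‖ N^(s-1)`
    have h4 : ‖hfp.toLp f‖ = N ^ (s - 1) := by
      have : N ^ s = (N ^ (s - 1)) ^ r := by
        rw [← Real.rpow_mul hN0, hrs.symm.sub_one_mul_conj]
      rw [this] at h3
      exact (Real.rpow_left_injOn (show r ≠ 0 by linarith)) (norm_nonneg _)
        (Real.rpow_nonneg hN0 _) h3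
    rw [h1, h4, Complex.norm_real, Real.norm_eq_abs, abs_of_nonneg (by positivity)] at h2
    rcases hN0.eq_or_lt with h | h
    · rw [← h]; exact norm_nonneg _
    · have h5 : N ^ s = N * N ^ (s - 1) := by
        nth_rewrite 2 [← Real.rpow_one N]
        rw [← Real.rpow_add h]; congr 1; ring
      rw [h5] at h2
      exact le_of_mul_le_mul_right h2 (by positivity)
  refine ⟨hgm.aestronglyMeasurable, ?_⟩
  have hlim := Lp.eLpNorm_lim_le_liminf_eLpNorm (p := q) (fun n => (hGm n).aestronglyMeasurable
    (μ := μ)) g (Eventually.of_forall fun x => by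
      obtain ⟨N, hN⟩ := exists_nat_ge ‖g x‖
      refine tendsto_const_nhds.congr' ?_
      filter_upwards [eventually_ge_atTop N] with n hn
      exact (indicator_of_mem (s := {x | ‖g x‖ ≤ n})
        (hN.trans (by exact_mod_cast hn)) g).symm)
  refine hlim.trans_lt (lt_of_le_of_lt ?_ (ENNReal.ofReal_lt_top (r := ‖L‖)))
  refine liminf_le_of_frequently_le' (Frequently.of_forall fun n => ?_)
  rw [← ENNReal.ofReal_toReal (hGq n).2.ne]
  exact ENNReal.ofReal_le_ofReal (key n)

/-- The **Riesz representation theorem** for `L^p`, `1 < p < ∞`, over a finite measure. -/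
theorem exists_memLp_forall_eq_integral (hp1 : 1 < p) (hp : p ≠ ∞) (hpq : p.HolderConjugate q)
    (L : StrongDual ℂ (Lp ℂ p μ)) :
    ∃ g : α → ℂ, MemLp g q μ ∧ ∀ f : Lp ℂ p μ, L f = ∫ x, f x * g x ∂μ := by
  obtain ⟨g₀, hg₀, hL₀⟩ := exists_density hp L
  obtain ⟨g, hgm, hgg⟩ : ∃ g, Measurable g ∧ g₀ =ᵐ[μ] g :=
    ⟨hg₀.1.mk g₀, hg₀.1.stronglyMeasurable_mk.measurable, hg₀.1.ae_eq_mk⟩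
  have hg : Integrable g μ := hg₀.congr hgg
  have hL : ∀ (E : Set α) (hE : MeasurableSet E),
      L (indicatorConstLp p hE (measure_ne_top μ _) (1 : ℂ)) = ∫ x in E, g x ∂μ := fun E hE => by
    rw [hL₀]; exact integral_congr_ae (ae_restrict_of_ae hgg)
  have hgq := memLp_density hp1 hp hpq L hgm hg hL
  refine ⟨g, hgq, fun f => ?_⟩
  have : Fact (1 ≤ q) := ⟨hpq.symm.one_le⟩
  have hpq' : q.HolderConjugate p := hpq.symm
  let Φ := (ContinuousLinearMap.mul ℂ ℂ).lpPairing μ q p (hgq.toLp g)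
  have hΦ : ∀ f : Lp ℂ p μ, Φ f = ∫ x, f x * g x ∂μ := fun f => by
    simp only [Φ, ContinuousLinearMap.lpPairing_eq_integral, ContinuousLinearMap.mul_apply']
    refine integral_congr_ae ?_
    filter_upwards [hgq.coeFn_toLp] with x hx
    rw [hx, mul_comm]
  rw [← hΦ]
  refine Lp.induction hp (fun f => L f = Φ f) (fun c E hE hμE => ?_) (fun f g hf hg _ h1 h2 => ?_)
    (isClosed_eq L.continuous Φ.continuous) f
  · have : (Lp.simpleFunc.indicatorConst p hE hμE.ne c : Lp ℂ p μ) =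
        c • indicatorConstLp p hE (measure_ne_top μ _) (1 : ℂ) := by
      rw [Lp.simpleFunc.coe_indicatorConst, indicatorConstLp, indicatorConstLp,
        ← MemLp.toLp_const_smul]
      congr 1
      ext x
      by_cases hx : x ∈ E <;> simp [hx]
    rw [this, map_smul, map_smul, hL, hΦ, ← integral_indicator hE]
    congr 1
    refine integral_congr_ae ?_
    filter_upwards [indicatorConstLp_coeFn (p := p) (hs := hE) (hμs := measure_ne_top μ _)
      (c := (1 : ℂ))] with x hx
    rw [hx]
    by_cases hx : x ∈ E <;> simp [hx]
  · rw [map_add, map_add, h1, h2]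

end LpDual

/-! ### Fourier coefficients and Hardy spaces on the circle -/

section FourierCoefficients

open Filter Topology

theorem fourier_neg_apply (k : ℤ) (x : UnitCircle) :
    (fourier k (-x) : ℂ) = fourier (-k) x := by
  simp [fourier_apply]

theorem fourier_mul_fourier (j k : ℤ) (x : UnitCircle) :
    (fourier j x * fourier k x : ℂ) = fourier (j + k) x := (fourier_add).symm

theorem fourier_ne_zero (k : ℤ) (x : UnitCircle) : (fourier k x : ℂ) ≠ 0 := by
  rw [fourier_apply]; exact Circle.coe_ne_zero _

theorem fourierCoeff_eq_integral_mul (f : UnitCircle → ℂ) (k : ℤ) :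
    fourierCoeff f k = ∫ x, fourier (-k) x * f x ∂circleMeasure := rfl

theorem fourierCoeff_fourier_mul (f : UnitCircle → ℂ) (j k : ℤ) :
    fourierCoeff (fun x => fourier j x * f x) k = fourierCoeff f (k - j) := by
  rw [fourierCoeff_eq_integral_mul, fourierCoeff_eq_integral_mul]
  refine integral_congr_ae (Eventually.of_forall fun x => ?_)
  simp only
  rw [← mul_assoc, fourier_mul_fourier]
  congr 3; ring

theorem fourierCoeff_tilde (f : UnitCircle → ℂ) (k : ℤ) :
    fourierCoeff (tilde f) k = fourierCoeff f (-k) := by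
  rw [fourierCoeff_eq_integral_mul, fourierCoeff_eq_integral_mul,
    ← integral_neg_eq_self (fun x : UnitCircle => (fourier (-k) x * tilde f x : ℂ))]
  simp only [tilde, fourier_neg_apply, neg_neg]

theorem fourierCoeff_fourier_apply (j k : ℤ) :
    fourierCoeff (fun x : UnitCircle => (fourier j x : ℂ)) k = if k = j then 1 else 0 := by
  rw [fourierCoeff_eq_integral_mul]
  simp only [fourier_mul_fourier]
  rw [Riesz.integral_fourier]
  congr 1
  simp only [eq_iff_iff]
  omega

/-- An integrable function is orthogonal to all continuous functions as soon as all of its Fourier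
coefficients vanish. -/
theorem integral_mul_continuous_eq_zero {f : UnitCircle → ℂ} (hf : Integrable f circleMeasure)
    (h : ∀ k, fourierCoeff f k = 0) (g : C(UnitCircle, ℂ)) :
    ∫ x, g x * f x ∂circleMeasure = 0 := by
  have hint : ∀ g : C(UnitCircle, ℂ), Integrable (fun x => g x * f x) circleMeasure := fun g =>
    hf.bdd_mul g.continuous.aestronglyMeasurable (Eventually.of_forall g.norm_coe_le_norm)
  let Φ : C(UnitCircle, ℂ) →ₗ[ℂ] ℂ :=
    { toFun := fun g => ∫ x, g x * f x ∂circleMeasure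
      map_add' := fun g g' => by
        rw [← integral_add (hint g) (hint g')]; simp [add_mul]
      map_smul' := fun z g => by
        simp [mul_assoc, integral_const_mul] }
  let Ψ := Φ.mkContinuous (∫ x, ‖f x‖ ∂circleMeasure) fun g => by
    refine (norm_integral_le_integral_norm _).trans ?_
    rw [mul_comm _ ‖g‖, ← integral_const_mul]
    refine integral_mono (hint g).norm (hf.norm.const_mul _) fun x => ?_
    simp only [norm_mul]
    gcongr
    exact g.norm_coe_le_norm x
  have hΨ : Ψ = 0 := by
    refine ContinuousLinearMap.ext_on (s := Set.range fourier) ?_ ?_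
    · rw [Submodule.dense_iff_topologicalClosure_eq_top, span_fourier_closure_eq_top]
    · rintro _ ⟨k, rfl⟩
      have := h (-k)
      rw [fourierCoeff_eq_integral_mul, neg_neg] at this
      exact this
  exact congrArg (fun T => T g) hΨ

/-- An integrable function is determined by its Fourier coefficients. -/
theorem ae_eq_zero_of_fourierCoeff_eq_zero {f : UnitCircle → ℂ}
    (hf : Integrable f circleMeasure) (h : ∀ k, fourierCoeff f k = 0) : f =ᵐ[circleMeasure] 0 := by
  refine ae_eq_zero_of_forall_setIntegral_isClosed_eq_zero hf fun F hF => ?_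
  let φ : ℕ → C(UnitCircle, ℂ) := fun n =>
    ⟨fun x => ((thickenedIndicator (δ := 1 / ((n : ℝ) + 1)) (by positivity) F x : ℝ) : ℂ),
      by fun_prop⟩
  have hφ : ∀ n, ∫ x, φ n x * f x ∂circleMeasure = 0 := fun n =>
    integral_mul_continuous_eq_zero hf h (φ n)
  have hlim : Tendsto (fun n => ∫ x, φ n x * f x ∂circleMeasure) atTop
      (𝓝 (∫ x, F.indicator f x ∂circleMeasure)) := by
    refine tendsto_integral_of_dominated_convergence (fun x => ‖f x‖)
      (fun n => (φ n).continuous.aestronglyMeasurable.mul hf.1) hf.norm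
      (fun n => Eventually.of_forall fun x => ?_) (Eventually.of_forall fun x => ?_)
    · rw [norm_mul]
      refine mul_le_of_le_one_left (norm_nonneg _) ?_
      simp only [φ, ContinuousMap.coe_mk, Complex.norm_real, NNReal.norm_eq]
      exact_mod_cast thickenedIndicator_le_one _ F x
    · have h1 := thickenedIndicator_tendsto_indicator_closure
        (δseq := fun n : ℕ => 1 / ((n : ℝ) + 1)) (fun n => by positivity)
        tendsto_one_div_add_atTop_nhds_zero_nat F
      rw [hF.closure_eq, tendsto_pi_nhds] at h1
      have h2 : Tendsto (fun n => φ n x) atTop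
          (𝓝 (((F.indicator (fun _ => (1 : NNReal)) x : NNReal) : ℝ) : ℂ)) :=
        (Complex.continuous_ofReal.tendsto _).comp ((NNReal.continuous_coe.tendsto _).comp (h1 x))
      have h3 := h2.mul_const (f x)
      convert h3 using 2
      by_cases hx : x ∈ F <;> simp [hx]
  simp only [hφ] at hlim
  rw [← integral_indicator hF.measurableSet]
  exact (tendsto_nhds_unique hlim tendsto_const_nhds)

theorem fourierCoeff_sub {f g : UnitCircle → ℂ} (hf : Integrable f circleMeasure)
    (hg : Integrable g circleMeasure) (k : ℤ) :
    fourierCoeff (f - g) k = fourierCoeff f k - fourierCoeff g k := by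
  rw [fourierCoeff, fourierCoeff, fourierCoeff,
    ← integral_sub (hf.fourier_smul _) (hg.fourier_smul _)]
  simp only [Pi.sub_apply, smul_sub]

theorem Lp_ext_fourierCoeff {p : ℝ≥0∞} [Fact (1 ≤ p)] {f g : Lp ℂ p circleMeasure}
    (h : ∀ k, fourierCoeff f k = fourierCoeff g k) : f = g := by
  have hf : Integrable f circleMeasure := (Lp.memLp f).integrable Fact.out
  have hg : Integrable g circleMeasure := (Lp.memLp g).integrable Fact.out
  refine Lp.ext ?_
  have := ae_eq_zero_of_fourierCoeff_eq_zero (hf.sub hg) fun k => by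
    rw [fourierCoeff_sub hf hg, h, sub_self]
  filter_upwards [this] with x hx
  exact sub_eq_zero.1 hx

theorem MemLp_fourier_mul {r : ℝ≥0∞} {f : UnitCircle → ℂ} (hf : MemLp f r circleMeasure) (j : ℤ) :
    MemLp (fun x => fourier j x * f x) r circleMeasure := by
  refine hf.of_le ((fourier j).continuous.aestronglyMeasurable.mul hf.1)
    (Eventually.of_forall fun x => ?_)
  rw [norm_mul, fourier_apply, Circle.norm_coe, one_mul]

theorem MemLp_tilde {r : ℝ≥0∞} {f : UnitCircle → ℂ} (hf : MemLp f r circleMeasure) :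
    MemLp (tilde f) r circleMeasure :=
  hf.comp_measurePreserving measurePreserving_neg_circle

theorem ae_tilde {P : UnitCircle → Prop} (h : ∀ᵐ x ∂circleMeasure, P x) :
    ∀ᵐ x ∂circleMeasure, P (-x) :=
  measurePreserving_neg_circle.quasiMeasurePreserving.ae h

theorem ae_fourier_one_ne (z : ℂ) : ∀ᵐ x ∂circleMeasure, (fourier 1 x : ℂ) ≠ z := by
  have hs : Set.Subsingleton {x : UnitCircle | (fourier 1 x : ℂ) = z} := by
    intro x hx y hy
    have h1 : (fourier 1 x : ℂ) = fourier 1 y := hx.trans hy.symm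
    rw [fourier_one, fourier_one] at h1
    exact AddCircle.injective_toCircle Real.two_pi_pos.ne' (Circle.coe_injective h1)
  rw [ae_iff]
  simp only [not_not]
  have hv : (volume : Measure UnitCircle) {x : UnitCircle | (fourier 1 x : ℂ) = z} = 0 := by
    rcases hs.eq_empty_or_singleton with h | ⟨y, h⟩
    · rw [h, measure_empty]
    · rw [h, ← Metric.closedBall_zero, AddCircle.volume_closedBall]
      simp [Real.pi_pos.le]
  rw [AddCircle.volume_eq_smul_haarAddCircle, Measure.smul_apply, smul_eq_mul, mul_eq_zero] at hv
  refine hv.resolve_left ?_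
  simp [Real.pi_pos]

theorem ae_one_add_ne_zero : ∀ᵐ x ∂circleMeasure, (1 + fourier 1 x : ℂ) ≠ 0 := by
  filter_upwards [ae_fourier_one_ne (-1)] with x hx h
  exact hx (by linear_combination h)

theorem ae_one_sub_ne_zero : ∀ᵐ x ∂circleMeasure, (1 - fourier 1 x : ℂ) ≠ 0 := by
  filter_upwards [ae_fourier_one_ne 1] with x hx h
  exact hx (by linear_combination -h)

end FourierCoefficients

section Hardy

open Filter Topology

variable {p q r : ℝ≥0∞}

theorem IsHardy.congr {f g : UnitCircle → ℂ} (hf : IsHardy r f) (h : f =ᵐ[circleMeasure] g) :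
    IsHardy r g :=
  ⟨hf.1.ae_eq h, fun k hk => by rw [← fourierCoeff_congr_ae h]; exact hf.2 k hk⟩

theorem IsHardy.fourier_mul {f : UnitCircle → ℂ} (hf : IsHardy r f) {j : ℤ} (hj : 0 ≤ j) :
    IsHardy r fun x => fourier j x * f x :=
  ⟨MemLp_fourier_mul hf.1 j, fun k hk => by
    rw [fourierCoeff_fourier_mul]; exact hf.2 _ (by omega)⟩

variable [Fact (1 ≤ p)]

theorem fourierCoeff_fourierLp (j k : ℤ) :
    fourierCoeff (fourierLp p j : Lp ℂ p circleMeasure) k = if k = j then 1 else 0 := by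
  rw [fourierCoeff_congr_ae (coeFn_fourierLp p j)]
  exact fourierCoeff_fourier_apply j k

theorem fourierLp_mem_hardySpace {j : ℤ} (hj : 0 ≤ j) :
    (fourierLp p j : Lp ℂ p circleMeasure) ∈ hardySpace p :=
  ⟨Lp.memLp _, fun k hk => by rw [fourierCoeff_fourierLp, if_neg (by omega)]⟩

theorem rieszProjection_eq_self (hp1 : 1 < p) (hp : p ≠ ∞) {f : Lp ℂ p circleMeasure}
    (hf : f ∈ hardySpace p) : rieszProjection p hp1 hp f = f := by
  refine Lp_ext_fourierCoeff fun k => ?_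
  rw [fourierCoeff_rieszProjection]
  split_ifs with h
  · rfl
  · exact (hf.2 k (by omega)).symm

theorem rieszProjection_eq_zero_iff (hp1 : 1 < p) (hp : p ≠ ∞) {f : Lp ℂ p circleMeasure} :
    rieszProjection p hp1 hp f = 0 ↔ ∀ k, 0 ≤ k → fourierCoeff f k = 0 := by
  have h0 : ∀ k, fourierCoeff (0 : Lp ℂ p circleMeasure) k = 0 := fun k => by
    rw [fourierCoeff_congr_ae (Lp.coeFn_zero ℂ p circleMeasure)]; simp [fourierCoeff]
  constructor
  · intro h k hk
    have := fourierCoeff_rieszProjection p hp1 hp f k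
    rw [h, if_pos hk, h0] at this
    exact this.symm
  · intro h
    refine Lp_ext_fourierCoeff fun k => ?_
    rw [fourierCoeff_rieszProjection, h0]
    split_ifs with hk
    · exact h k hk
    · rfl

theorem rieszProjection_fourierLp (hp1 : 1 < p) (hp : p ≠ ∞) (j : ℤ) :
    rieszProjection p hp1 hp (fourierLp p j) = if 0 ≤ j then fourierLp p j else 0 := by
  split_ifs with h
  · exact rieszProjection_eq_self hp1 hp (fourierLp_mem_hardySpace h)
  · rw [rieszProjection_eq_zero_iff]
    intro k hk
    rw [fourierCoeff_fourierLp, if_neg (by omega)]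

theorem ext_fourierLp (hp : p ≠ ∞) {L L' : StrongDual ℂ (Lp ℂ p circleMeasure)}
    (h : ∀ k, L (fourierLp p k) = L' (fourierLp p k)) : L = L' := by
  refine ContinuousLinearMap.ext_on (s := Set.range (fourierLp p)) ?_ ?_
  · rw [Submodule.dense_iff_topologicalClosure_eq_top, span_fourierLp_closure_eq_top hp]
  · rintro _ ⟨k, rfl⟩
    exact h k

/-- Analytic polynomials are dense in `H^p`: a functional on `L^p` vanishing on them vanishes
on `H^p`. -/
theorem functional_eq_zero_on_hardySpace (hp1 : 1 < p) (hp : p ≠ ∞)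
    (L : StrongDual ℂ (Lp ℂ p circleMeasure)) (h : ∀ k, 0 ≤ k → L (fourierLp p k) = 0)
    {f : Lp ℂ p circleMeasure} (hf : f ∈ hardySpace p) : L f = 0 := by
  have : L.comp (rieszProjection p hp1 hp) = 0 := ext_fourierLp hp fun k => by
    rw [ContinuousLinearMap.comp_apply, rieszProjection_fourierLp]
    split_ifs with hk
    · rw [h k hk]; rfl
    · simp
  have h1 := congrArg (fun T => T f) this
  simpa [rieszProjection_eq_self hp1 hp hf] using h1

/-- The product of functions in `H^p` and `H^q`, `1/p + 1/q = 1`, is in `H^1`. -/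
theorem IsHardy.mul [Fact (1 ≤ q)] [hpq : p.HolderConjugate q] (hp1 : 1 < p) (hp : p ≠ ∞)
    {f g : UnitCircle → ℂ} (hf : IsHardy p f) (hg : IsHardy q g) :
    IsHardy 1 fun x => f x * g x := by
  have hqp : q.HolderConjugate p := hpq.symm
  refine ⟨hg.1.mul hf.1, fun k hk => ?_⟩
  have hg' := MemLp_fourier_mul hg.1 (-k)
  let L := (ContinuousLinearMap.mul ℂ ℂ).lpPairing circleMeasure q p (hg'.toLp _)
  have hL : ∀ f : Lp ℂ p circleMeasure,
      L f = ∫ x, fourier (-k) x * g x * f x ∂circleMeasure := fun f => by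
    simp only [L, ContinuousLinearMap.lpPairing_eq_integral, ContinuousLinearMap.mul_apply']
    refine integral_congr_ae ?_
    filter_upwards [hg'.coeFn_toLp] with x hx
    rw [hx]
  have h1 : (hf.1.toLp f) ∈ hardySpace p := (hf.congr hf.1.coeFn_toLp.symm)
  have h2 := functional_eq_zero_on_hardySpace hp1 hp L (fun j hj => by
    rw [hL, ← hg.2 (k - j) (by omega), fourierCoeff_eq_integral_mul]
    refine integral_congr_ae ?_
    filter_upwards [coeFn_fourierLp (T := 2 * Real.pi) p j] with x hx
    rw [hx, mul_right_comm, fourier_mul_fourier]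
    congr 3; ring) h1
  rw [hL] at h2
  rw [← h2, fourierCoeff_eq_integral_mul]
  refine integral_congr_ae ?_
  filter_upwards [hf.1.coeFn_toLp] with x hx
  rw [hx]; ring

end Hardy

/-! ### The operators `L(a) + L(b) J` and the pairing of `L^p` with `L^q` -/

section Operators

open Filter Topology

variable {p q : ℝ≥0∞} [Fact (1 ≤ p)]

theorem coeFn_mulOp (a : Lp ℂ ∞ circleMeasure) (f : Lp ℂ p circleMeasure) :
    mulOp p a f =ᵐ[circleMeasure] fun x => a x * f x :=
  (ContinuousLinearMap.mul ℂ ℂ).coeFn_holder a f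

theorem coeFn_tildeOp (f : Lp ℂ p circleMeasure) :
    tildeOp p f =ᵐ[circleMeasure] fun x => f (-x) :=
  Lp.coeFn_compMeasurePreserving f measurePreserving_neg_circle

theorem coeFn_flipOp (f : Lp ℂ p circleMeasure) :
    flipOp p f =ᵐ[circleMeasure] fun x => fourier (-1) x * f (-x) := by
  filter_upwards [coeFn_mulOp (p := p) (fourierLp ∞ (-1)) (tildeOp p f), coeFn_tildeOp f,
    coeFn_fourierLp (T := 2 * Real.pi) ∞ (-1)] with x h1 h2 h3
  rw [flipOp, ContinuousLinearMap.comp_apply, h1, h2, h3]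

theorem fourierCoeff_flipOp (f : Lp ℂ p circleMeasure) (k : ℤ) :
    fourierCoeff (flipOp p f) k = fourierCoeff f (-1 - k) := by
  rw [fourierCoeff_congr_ae (coeFn_flipOp f), fourierCoeff_fourier_mul (fun x => f (-x))]
  refine (fourierCoeff_tilde f _).trans ?_
  congr 1; ring

theorem flipOp_flipOp (f : Lp ℂ p circleMeasure) : flipOp p (flipOp p f) = f := by
  refine Lp_ext_fourierCoeff fun k => ?_
  rw [fourierCoeff_flipOp, fourierCoeff_flipOp]
  congr 1; ring

/-- `Pg = 0` if and only if `Jg ∈ H^p`. -/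
theorem rieszProjection_eq_zero_iff_flipOp_mem (hp1 : 1 < p) (hp : p ≠ ∞)
    {g : Lp ℂ p circleMeasure} :
    rieszProjection p hp1 hp g = 0 ↔ flipOp p g ∈ hardySpace p := by
  rw [rieszProjection_eq_zero_iff]
  constructor
  · intro h
    refine ⟨Lp.memLp _, fun k hk => ?_⟩
    rw [fourierCoeff_flipOp]
    exact h _ (by omega)
  · intro h k hk
    have := h.2 (-1 - k) (by omega)
    rw [fourierCoeff_flipOp] at this
    rw [← this]; congr 1; ring

/-- The operator `L(a) + L(b) J` on `L^p`; its compression to `H^p` is `T(a) + H(b)`. -/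
noncomputable def mulAddFlip (p : ℝ≥0∞) [Fact (1 ≤ p)] (a b : Lp ℂ ∞ circleMeasure) :
    Lp ℂ p circleMeasure →L[ℂ] Lp ℂ p circleMeasure :=
  mulOp p a + (mulOp p b).comp (flipOp p)

theorem coeFn_mulAddFlip (a b : Lp ℂ ∞ circleMeasure) (f : Lp ℂ p circleMeasure) :
    mulAddFlip p a b f =ᵐ[circleMeasure]
      fun x => a x * f x + b x * (fourier (-1) x * f (-x)) := by
  filter_upwards [coeFn_mulOp a f, coeFn_mulOp b (flipOp p f), coeFn_flipOp f,
    Lp.coeFn_add (mulOp p a f) (mulOp p b (flipOp p f))] with x h1 h2 h3 h4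
  change (mulOp p a f + mulOp p b (flipOp p f) : Lp ℂ p circleMeasure) x = _
  rw [h4, Pi.add_apply, h1, h2, h3]

theorem coe_toeplitz_add_hankel (hp1 : 1 < p) (hp : p ≠ ∞) (a b : Lp ℂ ∞ circleMeasure)
    (f : hardySpace p) : (((toeplitz p hp1 hp a + hankel p hp1 hp b) f : hardySpace p) :
      Lp ℂ p circleMeasure) = rieszProjection p hp1 hp (mulAddFlip p a b f) := by
  change rieszProjection p hp1 hp (mulOp p a f) + rieszProjection p hp1 hp (mulOp p b (flipOp p f))
    = _
  rw [← map_add]; rfl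

variable [Fact (1 ≤ q)] [hpq : p.HolderConjugate q]

/-- The bilinear pairing `⟨f, g⟩ = (1/2π) ∫ f(t) g(t⁻¹)`, that is `∑ f_k g_k`, of `L^p` with
`L^q`. -/
noncomputable def circlePairing (p q : ℝ≥0∞) [Fact (1 ≤ p)] [Fact (1 ≤ q)] [p.HolderConjugate q] :
    Lp ℂ p circleMeasure →L[ℂ] Lp ℂ q circleMeasure →L[ℂ] ℂ :=
  ((ContinuousLinearMap.mul ℂ ℂ).lpPairing circleMeasure p q).bilinearComp
    (ContinuousLinearMap.id ℂ _) (tildeOp q)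

theorem circlePairing_apply (f : Lp ℂ p circleMeasure) (g : Lp ℂ q circleMeasure) :
    circlePairing p q f g = ∫ x, f x * g (-x) ∂circleMeasure := by
  simp only [circlePairing, ContinuousLinearMap.bilinearComp_apply, ContinuousLinearMap.id_apply,
    ContinuousLinearMap.lpPairing_eq_integral, ContinuousLinearMap.mul_apply']
  refine integral_congr_ae ?_
  filter_upwards [coeFn_tildeOp g] with x hx
  rw [hx]

theorem circlePairing_fourierLp_left (k : ℤ) (g : Lp ℂ q circleMeasure) :
    circlePairing p q (fourierLp p k) g = fourierCoeff g k := by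
  rw [circlePairing_apply, fourierCoeff_eq_integral_mul,
    ← integral_neg_eq_self (fun x : UnitCircle => (fourier (-k) x * g x : ℂ))]
  refine integral_congr_ae ?_
  filter_upwards [coeFn_fourierLp (T := 2 * Real.pi) p k] with x hx
  rw [hx, fourier_neg_apply, neg_neg]

theorem circlePairing_rieszProjection (hp1 : 1 < p) (hp : p ≠ ∞) (hq1 : 1 < q) (hq : q ≠ ∞)
    (f : Lp ℂ p circleMeasure) (g : Lp ℂ q circleMeasure) :
    circlePairing p q (rieszProjection p hp1 hp f) g =
      circlePairing p q f (rieszProjection q hq1 hq g) := by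
  have : ((circlePairing p q).flip g).comp (rieszProjection p hp1 hp) =
      (circlePairing p q).flip (rieszProjection q hq1 hq g) := ext_fourierLp hp fun k => by
    rw [ContinuousLinearMap.comp_apply, rieszProjection_fourierLp, ContinuousLinearMap.flip_apply,
      ContinuousLinearMap.flip_apply, circlePairing_fourierLp_left, fourierCoeff_rieszProjection]
    split_ifs
    · rw [circlePairing_fourierLp_left]
    · simp
  exact congrArg (fun T => T f) this

/-- `L(ã) + L(b) J` is the transpose of `L(a) + L(b) J`. -/
theorem circlePairing_mulAddFlip (a b : Lp ℂ ∞ circleMeasure)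
    (f : Lp ℂ p circleMeasure) (g : Lp ℂ q circleMeasure) :
    circlePairing p q (mulAddFlip p a b f) g =
      circlePairing p q f (mulAddFlip q (tildeOp ∞ a) b g) := by
  have hmul : ∀ (f : Lp ℂ p circleMeasure) (g : Lp ℂ q circleMeasure),
      Integrable (fun x => f x * g (-x)) circleMeasure := fun f g =>
    memLp_one_iff_integrable.1 ((MemLp_tilde (Lp.memLp g)).mul (Lp.memLp f))
  rw [mulAddFlip, mulAddFlip]
  simp only [_root_.add_apply, ContinuousLinearMap.comp_apply, map_add]
  congr 1
  · rw [circlePairing_apply, circlePairing_apply]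
    refine integral_congr_ae ?_
    filter_upwards [coeFn_mulOp a f, ae_tilde (coeFn_mulOp (tildeOp ∞ a) g),
      ae_tilde (coeFn_tildeOp a)] with x h1 h2 h3
    rw [h1, h2, h3, neg_neg]; ring
  · rw [circlePairing_apply, circlePairing_apply,
      ← integral_neg_eq_self (fun x : UnitCircle => f x * mulOp q b (flipOp q g) (-x))]
    refine integral_congr_ae ?_
    filter_upwards [coeFn_mulOp b (flipOp p f), coeFn_flipOp f, coeFn_mulOp b (flipOp q g),
      coeFn_flipOp g] with x h1 h2 h3 h4
    rw [neg_neg, h1, h2, h3, h4]; ring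

theorem exists_circlePairing_eq (hp1 : 1 < p) (hp : p ≠ ∞)
    (L : StrongDual ℂ (Lp ℂ p circleMeasure)) :
    ∃ g : Lp ℂ q circleMeasure, ∀ f, L f = circlePairing p q f g := by
  obtain ⟨g, hg, hL⟩ := exists_memLp_forall_eq_integral hp1 hp hpq L
  refine ⟨(MemLp_tilde hg).toLp _, fun f => ?_⟩
  rw [hL, circlePairing_apply]
  refine integral_congr_ae ?_
  filter_upwards [ae_tilde (MemLp_tilde hg).coeFn_toLp] with x hx
  rw [hx, tilde, neg_neg]

end Operators

/-! ### Solutions of `h = d · J h` in `H^p` -/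

section FlipEigenspace

open Filter Topology

theorem fourier_neg_eq_inv (k : ℤ) (x : UnitCircle) : (fourier (-k) x : ℂ) = (fourier k x)⁻¹ := by
  refine eq_inv_of_mul_eq_one_left ?_
  rw [fourier_mul_fourier]; simp

theorem fourier_two_mul (k : ℤ) (x : UnitCircle) : (fourier (2 * k) x : ℂ) = fourier k x ^ 2 := by
  rw [sq, fourier_mul_fourier, two_mul k]

theorem fourier_sub_eq_div (j k : ℤ) (x : UnitCircle) :
    (fourier (j - k) x : ℂ) = fourier j x / fourier k x := by
  rw [sub_eq_add_neg, fourier_add, fourier_neg_eq_inv, div_eq_mul_inv]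

/-- The even trigonometric polynomial `∑ y_j (t^j + t^{-j})`, `0 ≤ j < N`. The term `j = 0` is
`2 y_0`. -/
noncomputable def evenPoly {N : ℕ} (y : Fin N → ℂ) (x : UnitCircle) : ℂ :=
  ∑ j : Fin N, y j * (fourier j x + fourier (-j) x)

theorem evenPoly_neg {N : ℕ} (y : Fin N → ℂ) (x : UnitCircle) :
    evenPoly y (-x) = evenPoly y x := by
  refine Finset.sum_congr rfl fun j _ => ?_
  rw [fourier_neg_apply, fourier_neg_apply, neg_neg, add_comm]

theorem evenPoly_add {N : ℕ} (y z : Fin N → ℂ) (x : UnitCircle) :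
    evenPoly (y + z) x = evenPoly y x + evenPoly z x := by
  simp only [evenPoly, Pi.add_apply, add_mul, Finset.sum_add_distrib]

theorem evenPoly_smul {N : ℕ} (c : ℂ) (y : Fin N → ℂ) (x : UnitCircle) :
    evenPoly (c • y) x = c * evenPoly y x := by
  simp only [evenPoly, Pi.smul_apply, smul_eq_mul, mul_assoc, Finset.mul_sum]

theorem fourierCoeff_evenPoly {N : ℕ} (y : Fin N → ℂ) (i : Fin N) :
    fourierCoeff (evenPoly y) i = if (i : ℕ) = 0 then 2 * y i else y i := by
  have hI : ∀ f : UnitCircle → ℂ, Continuous f → Integrable f circleMeasure := fun f hf =>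
    hf.integrable_of_hasCompactSupport (HasCompactSupport.of_compactSpace f)
  have h1 : ∀ j : Fin N, fourierCoeff
      (fun x : UnitCircle => y j * ((fourier j x : ℂ) + fourier (-j) x)) i =
      if j = i then (if (i : ℕ) = 0 then 2 * y i else y i) else 0 := by
    intro j
    rw [fourierCoeff.const_mul]
    have := fourierCoeff.add (hI _ (fourier (T := 2 * Real.pi) j).continuous)
      (hI _ (fourier (T := 2 * Real.pi) (-j)).continuous)
    have h2 := congrFun this (i : ℤ)
    rw [Pi.add_apply, fourierCoeff_fourier_apply, fourierCoeff_fourier_apply] at h2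
    change y j * fourierCoeff (⇑(fourier (T := 2 * Real.pi) (j : ℤ)) + ⇑(fourier (-(j : ℤ)))) i = _
    rw [h2]
    by_cases hj : j = i
    · subst hj
      by_cases h0 : (j : ℕ) = 0
      · simp [h0]; ring
      · rw [if_pos rfl, if_neg (by omega), if_pos rfl, if_neg h0]; ring
    · have hj' : (j : ℕ) ≠ i := fun h => hj (Fin.ext h)
      rw [if_neg (by omega), if_neg (by omega), if_neg hj]; ring
  have h3 := fourierCoeff.sum Finset.univ
    (fun (j : Fin N) (x : UnitCircle) => y j * ((fourier j x : ℂ) + fourier (-j) x))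
    fun j _ => hI _ (by fun_prop)
  have h4 : evenPoly y = ∑ j : Fin N, fun x : UnitCircle =>
      y j * ((fourier j x : ℂ) + fourier (-j) x) := by
    ext x; simp [evenPoly]
  rw [h4, h3, Finset.sum_apply]
  simp only [h1]
  simp

variable {p q r : ℝ≥0∞}

theorem IsHardy.add {f g : UnitCircle → ℂ} (hr : 1 ≤ r) (hf : IsHardy r f) (hg : IsHardy r g) :
    IsHardy r (f + g) :=
  ⟨hf.1.add hg.1, fun k hk => by
    rw [fourierCoeff.add (hf.1.integrable hr) (hg.1.integrable hr), Pi.add_apply, hf.2 k hk,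
      hg.2 k hk, add_zero]⟩

theorem IsHardy.const_mul {f : UnitCircle → ℂ} (hf : IsHardy r f) (c : ℂ) :
    IsHardy r fun x => c * f x :=
  ⟨hf.1.const_mul c, fun k hk => by rw [fourierCoeff.const_mul, hf.2 k hk, mul_zero]⟩

theorem isHardy_zero : IsHardy r (fun _ => (0 : ℂ)) :=
  ⟨MemLp.zero, fun k _ => by simp [fourierCoeff]⟩

theorem isHardy_sum {ι : Type*} (hr : 1 ≤ r) (s : Finset ι) {f : ι → UnitCircle → ℂ}
    (h : ∀ i ∈ s, IsHardy r (f i)) : IsHardy r fun x => ∑ i ∈ s, f i x := by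
  classical
  induction s using Finset.induction_on with
  | empty => simpa using isHardy_zero
  | insert i s hi ih =>
    simp only [Finset.sum_insert hi]
    exact IsHardy.add hr (h i (by simp)) (ih fun j hj => h j (by simp [hj]))

/-- All powers `t^{m-1±j}`, `0 ≤ j < m`, that occur in the product `t^{m-1} s_y` are nonnegative. -/
theorem IsHardy.evenPoly_mul (hr : 1 ≤ r) {u : UnitCircle → ℂ} (hu : IsHardy r u) {m : ℤ}
    (y : Fin m.toNat → ℂ) : IsHardy r fun x => fourier (m - 1) x * evenPoly y x * u x := by
  have h : ∀ j : Fin m.toNat, IsHardy r fun x =>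
      y j * (fourier (m - 1 + j) x * u x + fourier (m - 1 - j) x * u x) := fun j =>
    IsHardy.const_mul (IsHardy.add hr (hu.fourier_mul (by omega)) (hu.fourier_mul (by omega))) _
  refine (isHardy_sum hr Finset.univ fun j _ => h j).congr (Eventually.of_forall fun x => ?_)
  simp only [evenPoly, Finset.mul_sum, Finset.sum_mul]
  refine Finset.sum_congr rfl fun j _ => ?_
  rw [sub_eq_add_neg (m - 1), fourier_add, fourier_add]; ring

theorem IsAntisymmFactor.ne_zero {d dp : UnitCircle → ℂ} {m : ℤ}
    (h : IsAntisymmFactor p q d dp m)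
    (hd : ∀ᵐ x ∂circleMeasure, d x ≠ 0) : ∀ᵐ x ∂circleMeasure, dp x ≠ 0 := by
  filter_upwards [hd, h.eq] with x h1 h2 h3
  rw [h3, zero_mul, zero_mul] at h2
  exact h1 h2

variable [Fact (1 ≤ p)]

/-- The space of all `h ∈ H^p` such that `h = d · J h`. -/
def flipEigenspace (p : ℝ≥0∞) [Fact (1 ≤ p)] (d : UnitCircle → ℂ) :
    Submodule ℂ (Lp ℂ p circleMeasure) where
  carrier := {h | h ∈ hardySpace p ∧
    ∀ᵐ x ∂circleMeasure, h x = d x * (fourier (-1) x * h (-x))}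
  zero_mem' := by
    refine ⟨zero_mem _, ?_⟩
    filter_upwards [Lp.coeFn_zero ℂ p circleMeasure, ae_tilde (Lp.coeFn_zero ℂ p circleMeasure)]
      with x h1 h2
    rw [h1, h2]; simp
  add_mem' := by
    rintro f g ⟨hf, hf'⟩ ⟨hg, hg'⟩
    refine ⟨add_mem hf hg, ?_⟩
    filter_upwards [Lp.coeFn_add f g, ae_tilde (Lp.coeFn_add f g), hf', hg'] with x h1 h2 h3 h4
    rw [h1, h2, Pi.add_apply, Pi.add_apply]
    linear_combination h3 + h4
  smul_mem' := by
    rintro c f ⟨hf, hf'⟩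
    refine ⟨Submodule.smul_mem _ _ hf, ?_⟩
    filter_upwards [Lp.coeFn_smul c f, ae_tilde (Lp.coeFn_smul c f), hf'] with x h1 h2 h3
    rw [h1, h2, Pi.smul_apply, Pi.smul_apply, smul_eq_mul, smul_eq_mul]
    linear_combination c * h3

variable {d dp : UnitCircle → ℂ} {m : ℤ}

/-- The functions `(1+t) d₊ t^{m-1} s` with `s` an even trigonometric polynomial of degree at most
`m - 1`, as a linear family in `L^p`. -/
noncomputable def eigenMap (h : IsAntisymmFactor p q d dp m) :
    (Fin m.toNat → ℂ) →ₗ[ℂ] Lp ℂ p circleMeasure where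
  toFun y := (h.hardy.evenPoly_mul Fact.out y).1.toLp _
  map_add' y z := by
    rw [← MemLp.toLp_add]
    congr 1
    ext x
    simp only [evenPoly_add, Pi.add_apply]; ring
  map_smul' c y := by
    rw [RingHom.id_apply, ← MemLp.toLp_const_smul]
    congr 1
    ext x
    simp only [evenPoly_smul, Pi.smul_apply, smul_eq_mul]; ring

theorem coeFn_eigenMap (h : IsAntisymmFactor p q d dp m) (y : Fin m.toNat → ℂ) :
    eigenMap h y =ᵐ[circleMeasure]
      fun x => fourier (m - 1) x * evenPoly y x * ((1 + fourier 1 x) * dp x) :=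
  (h.hardy.evenPoly_mul Fact.out y).1.coeFn_toLp

theorem eigenMap_injective (h : IsAntisymmFactor p q d dp m)
    (hd : ∀ᵐ x ∂circleMeasure, d x ≠ 0) : Function.Injective (eigenMap h) := by
  rw [← LinearMap.ker_eq_bot, LinearMap.ker_eq_bot']
  intro y hy
  have h0 : evenPoly y =ᵐ[circleMeasure] 0 := by
    have h1 := coeFn_eigenMap h y
    rw [hy] at h1
    filter_upwards [h1, Lp.coeFn_zero ℂ p circleMeasure, h.ne_zero hd, ae_one_add_ne_zero]
      with x h1 h2 h3 h4
    rw [h2, Pi.zero_apply, eq_comm, mul_eq_zero, mul_eq_zero] at h1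
    rcases h1 with (h1 | h1) | h1
    · exact absurd h1 (fourier_ne_zero _ _)
    · exact h1
    · exact absurd h1 (mul_ne_zero h4 h3)
  funext i
  have h1 := fourierCoeff_evenPoly y i
  rw [fourierCoeff_congr_ae h0] at h1
  have h2 : fourierCoeff (0 : UnitCircle → ℂ) (i : ℤ) = 0 := by simp [fourierCoeff]
  rw [h2] at h1
  split_ifs at h1
  · simpa using h1.symm
  · exact h1.symm

theorem eigenMap_mem (h : IsAntisymmFactor p q d dp m) (hd : ∀ᵐ x ∂circleMeasure, d x ≠ 0)
    (y : Fin m.toNat → ℂ) : eigenMap h y ∈ flipEigenspace p d := by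
  refine ⟨(h.hardy.evenPoly_mul Fact.out y).congr (coeFn_eigenMap h y).symm, ?_⟩
  filter_upwards [coeFn_eigenMap h y, ae_tilde (coeFn_eigenMap h y), h.eq,
    ae_tilde (h.ne_zero hd)] with x h1 h2 h3 h4
  rw [h1, h2, h3]
  simp only [tilde, evenPoly_neg, fourier_neg_apply, fourier_neg_eq_inv, fourier_two_mul,
    fourier_sub_eq_div]
  have := fourier_ne_zero m x
  have := fourier_ne_zero 1 x
  field_simp
  ring

/-- The function `v = (1-t) d₊⁻¹ f ∈ H^1` satisfies `v(t) = -t^{2m} v(t⁻¹)`. -/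
theorem fourierCoeff_mul_inv (h : IsAntisymmFactor p q d dp m)
    (hd : ∀ᵐ x ∂circleMeasure, d x ≠ 0) {f : Lp ℂ p circleMeasure}
    (hf : f ∈ flipEigenspace p d) (k : ℤ) :
    fourierCoeff (fun x => f x * ((1 - fourier 1 x) * (dp x)⁻¹)) k =
      -fourierCoeff (fun x => f x * ((1 - fourier 1 x) * (dp x)⁻¹)) (2 * m - k) := by
  set v : UnitCircle → ℂ := fun x => f x * ((1 - fourier 1 x) * (dp x)⁻¹) with hv
  have h1 : v =ᵐ[circleMeasure] fun x => (-1 : ℂ) * (fourier (2 * m) x * tilde v x) := by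
    filter_upwards [hf.2, h.eq, h.ne_zero hd, ae_tilde (h.ne_zero hd)] with x h1 h2 h3 h4
    simp only [hv, tilde]
    rw [h1, h2]
    simp only [tilde, fourier_neg_apply, fourier_neg_eq_inv, fourier_two_mul]
    have := fourier_ne_zero m x
    have := fourier_ne_zero 1 x
    field_simp
    ring
  refine (congrFun (fourierCoeff_congr_ae h1) k).trans ?_
  rw [fourierCoeff.const_mul, fourierCoeff_fourier_mul (tilde v), fourierCoeff_tilde, neg_one_mul,
    neg_sub]

section Dimension

variable [Fact (1 ≤ q)] [hpq : p.HolderConjugate q]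

theorem isHardy_mul_inv (hp1 : 1 < p) (hp : p ≠ ∞) (h : IsAntisymmFactor p q d dp m)
    {f : Lp ℂ p circleMeasure} (hf : f ∈ flipEigenspace p d) :
    IsHardy 1 fun x => f x * ((1 - fourier 1 x) * (dp x)⁻¹) :=
  IsHardy.mul hp1 hp hf.1 h.hardy_inv

/-- The Fourier coefficients of `v = (1-t) d₊⁻¹ f` at `m + 1, …, 2m`, which determine `f`. -/
noncomputable def coeffMap (hp1 : 1 < p) (hp : p ≠ ∞) (h : IsAntisymmFactor p q d dp m) :
    flipEigenspace p d →ₗ[ℂ] (Fin m.toNat → ℂ) where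
  toFun f i := fourierCoeff (fun x => (f : Lp ℂ p circleMeasure) x *
    ((1 - fourier 1 x) * (dp x)⁻¹)) (m + 1 + i)
  map_add' f g := by
    funext i
    have := congrFun (fourierCoeff.add
      ((isHardy_mul_inv hp1 hp h f.2).1.integrable le_rfl)
      ((isHardy_mul_inv hp1 hp h g.2).1.integrable le_rfl)) (m + 1 + i)
    rw [Pi.add_apply, ← Pi.add_apply, ← this]
    refine congrFun (fourierCoeff_congr_ae ?_) _
    filter_upwards [Lp.coeFn_add (f : Lp ℂ p circleMeasure) g] with x hx
    rw [Submodule.coe_add, hx, Pi.add_apply, Pi.add_apply, add_mul]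
  map_smul' c f := by
    funext i
    rw [RingHom.id_apply, Pi.smul_apply, smul_eq_mul, ← fourierCoeff.const_mul]
    refine congrFun (fourierCoeff_congr_ae ?_) _
    filter_upwards [Lp.coeFn_smul c (f : Lp ℂ p circleMeasure)] with x hx
    rw [Submodule.coe_smul, hx, Pi.smul_apply, smul_eq_mul, mul_assoc]

theorem coeffMap_injective (hp1 : 1 < p) (hp : p ≠ ∞) (h : IsAntisymmFactor p q d dp m)
    (hd : ∀ᵐ x ∂circleMeasure, d x ≠ 0) : Function.Injective (coeffMap hp1 hp h) := by
  rw [← LinearMap.ker_eq_bot, LinearMap.ker_eq_bot']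
  intro f hf
  have hH := isHardy_mul_inv hp1 hp h f.2
  have hsymm := fourierCoeff_mul_inv h hd f.2
  have h1 : ∀ k : ℤ, m < k → fourierCoeff (fun x => (f : Lp ℂ p circleMeasure) x *
      ((1 - fourier 1 x) * (dp x)⁻¹)) k = 0 := by
    intro k hk
    rcases le_or_gt k (2 * m) with h2 | h2
    · have := congrFun hf ⟨(k - m - 1).toNat, by omega⟩
      change fourierCoeff _ (m + 1 + ((k - m - 1).toNat : ℤ)) = 0 at this
      rwa [show m + 1 + ((k - m - 1).toNat : ℤ) = k by omega] at this
    · rw [hsymm, hH.2 _ (by omega), neg_zero]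
  have h2 : ∀ k : ℤ, fourierCoeff (fun x => (f : Lp ℂ p circleMeasure) x *
      ((1 - fourier 1 x) * (dp x)⁻¹)) k = 0 := by
    intro k
    rcases lt_trichotomy k m with h2 | h2 | h2
    · rw [hsymm, h1 _ (by omega), neg_zero]
    · have := hsymm k
      rw [show 2 * m - k = k by omega] at this
      exact self_eq_neg.1 this
    · exact h1 k h2
  have h3 := ae_eq_zero_of_fourierCoeff_eq_zero (hH.1.integrable le_rfl) h2
  refine Subtype.ext (Lp.ext ?_)
  filter_upwards [h3, h.ne_zero hd, ae_one_sub_ne_zero, Lp.coeFn_zero ℂ p circleMeasure]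
    with x h4 h5 h6 h7
  rw [Submodule.coe_zero, h7]
  exact (mul_eq_zero.1 h4).resolve_right (mul_ne_zero h6 (inv_ne_zero h5))

theorem finiteDimensional_flipEigenspace (hp1 : 1 < p) (hp : p ≠ ∞)
    (h : IsAntisymmFactor p q d dp m) (hd : ∀ᵐ x ∂circleMeasure, d x ≠ 0) :
    FiniteDimensional ℂ (flipEigenspace p d) :=
  FiniteDimensional.of_injective _ (coeffMap_injective hp1 hp h hd)

/-- All solutions of `h = d · J h` in `H^p` are of the form `(1+t) d₊ t^{m-1} s`: the coefficient
map bounds the dimension from above, and the family `eigenMap` attains the bound. -/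
theorem range_eigenMap (hp1 : 1 < p) (hp : p ≠ ∞) (h : IsAntisymmFactor p q d dp m)
    (hd : ∀ᵐ x ∂circleMeasure, d x ≠ 0) :
    LinearMap.range (eigenMap h) = flipEigenspace p d := by
  have := finiteDimensional_flipEigenspace hp1 hp h hd
  refine Submodule.eq_of_le_of_finrank_le ?_ ?_
  · rintro _ ⟨y, rfl⟩
    exact eigenMap_mem h hd y
  · rw [LinearMap.finrank_range_of_inj (eigenMap_injective h hd)]
    exact LinearMap.finrank_le_finrank_of_injective (coeffMap_injective hp1 hp h hd)

theorem finrank_flipEigenspace (hp1 : 1 < p) (hp : p ≠ ∞) (h : IsAntisymmFactor p q d dp m)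
    (hd : ∀ᵐ x ∂circleMeasure, d x ≠ 0) :
    Module.finrank ℂ (flipEigenspace p d) = m.toNat := by
  rw [← range_eigenMap hp1 hp h hd, LinearMap.finrank_range_of_inj (eigenMap_injective h hd)]
  simp

end Dimension

end FlipEigenspace

/-! ### Closed ranges -/

section ClosedRange

variable {E F : Type*} [NormedAddCommGroup E] [NormedSpace ℂ E] [NormedAddCommGroup F]
  [NormedSpace ℂ F]

/-- If a Fredholm operator factors as `P ∘ B`, then `B` has closed range: on a complement of the
kernel of `P ∘ B` the operator `B` has a bounded left inverse `Q`, so that its range there is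
`{y : B (Q y) = y}`. -/
theorem isClosed_range_of_isFredholm_comp (B : E →L[ℂ] F) (P : F →L[ℂ] E)
    (h : (P.comp B).IsFredholm) : IsClosed (LinearMap.range B.toLinearMap : Set F) := by
  obtain ⟨pkg⟩ := h.nonempty_fredholmPackage
  let Q : F →L[ℂ] pkg.decDom.X₁ :=
    (pkg.equiv.symm : pkg.decCodom.X₁ →L[ℂ] pkg.decDom.X₁).comp (pkg.decCodom.proj.comp P)
  have hQ : ∀ x : pkg.decDom.X₁, Q (B x) = x := by
    intro x
    have h1 : P (B x) = (pkg.equiv x : E) := by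
      change (P.comp B) x = _
      have := congrArg (fun T : E →L[ℂ] E => T x) pkg.eq_equiv
      simpa using this
    change pkg.equiv.symm (pkg.decCodom.proj (P (B x))) = x
    rw [h1]
    simp
  have h1 : IsClosed ((pkg.decDom.X₁.map B.toLinearMap : Submodule ℂ F) : Set F) := by
    have : ((pkg.decDom.X₁.map B.toLinearMap : Submodule ℂ F) : Set F) = {y | B (Q y) = y} := by
      ext y
      constructor
      · rintro ⟨x, hx, rfl⟩
        exact congrArg (fun z : pkg.decDom.X₁ => B z) (hQ ⟨x, hx⟩)
      · intro hy
        exact ⟨Q y, (Q y).2, hy⟩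
    rw [this]
    exact isClosed_eq (by fun_prop) continuous_id
  have h2 : LinearMap.range B.toLinearMap =
      pkg.decDom.X₁.map B.toLinearMap ⊔ pkg.decDom.X₀.map B.toLinearMap := by
    rw [← Submodule.map_sup, pkg.decDom.isTopCompl.isCompl.sup_eq_top, LinearMap.range_eq_map]
  rw [h2]
  have := pkg.decDom.finite_X₀
  exact Submodule.isClosed_sup_finiteDimensional _ _ h1

theorem exists_functional_of_notMem {S : Submodule ℂ F} (hS : IsClosed (S : Set F)) {x : F}
    (hx : x ∉ S) : ∃ L : StrongDual ℂ F, (∀ y ∈ S, L y = 0) ∧ L x ≠ 0 := by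
  -- the quotient norm on `F ⧸ S` needs this as an instance
  have : IsClosed (S : Set F) := hS
  obtain ⟨L, hL⟩ := SeparatingDual.exists_ne_zero (R := ℂ) (V := F ⧸ S) (x := S.mkQ x)
    (by simpa using hx)
  exact ⟨L.comp S.mkQL, fun y hy => by simp [(Submodule.Quotient.mk_eq_zero S).2 hy], hL⟩

end ClosedRange

/-! ### The kernel of `T(a) + H(b)` -/

section Kernel

open Filter Topology

variable {p q : ℝ≥0∞} {a b : Lp ℂ ∞ circleMeasure} {c d cp dp : UnitCircle → ℂ} {n m : ℤ}

theorem IsInvertibleLinfty.ne_zero {a : Lp ℂ ∞ circleMeasure} (h : IsInvertibleLinfty a) :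
    ∀ᵐ x ∂circleMeasure, a x ≠ 0 := by
  obtain ⟨a', ha⟩ := h
  filter_upwards [ha] with x hx h0
  rw [h0, zero_mul] at hx
  exact zero_ne_one hx

theorem IsInvertibleLinfty.tildeOp {a : Lp ℂ ∞ circleMeasure} (h : IsInvertibleLinfty a) :
    IsInvertibleLinfty (tildeOp ∞ a) := by
  obtain ⟨a', ha⟩ := h
  refine ⟨_root_.tildeOp ∞ a', ?_⟩
  filter_upwards [ae_tilde ha, coeFn_tildeOp a, coeFn_tildeOp a'] with x h1 h2 h3
  rw [h2, h3, h1]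

namespace BasicFactorization

variable (hfac : BasicFactorization p q a b c d cp dp n m)

include hfac

/-- The factorization conditions are invariant under exchanging `p` with `q`, `a` with `ã`, `c`
with `d`, and `n` with `m`. -/
theorem symm : BasicFactorization q p (_root_.tildeOp ∞ a) b d c dp cp m n where
  inv_a := hfac.inv_a.tildeOp
  inv_b := hfac.inv_b
  tilde_eq := by
    filter_upwards [hfac.tilde_eq, coeFn_tildeOp a, ae_tilde (coeFn_tildeOp a)] with x h1 h2 h3
    rw [tilde, h2, h3, neg_neg, mul_comm]
    exact h1
  c_eq := by
    filter_upwards [hfac.d_eq, coeFn_tildeOp a] with x h1 h2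
    rw [h2, h1, tilde]
  d_eq := by
    filter_upwards [hfac.c_eq, ae_tilde (coeFn_tildeOp a)] with x h1 h2
    rw [tilde, h2, h1, neg_neg]
  c_fac := hfac.d_fac
  d_fac := hfac.c_fac

theorem c_ne_zero : ∀ᵐ x ∂circleMeasure, c x ≠ 0 := by
  filter_upwards [hfac.c_eq, hfac.inv_a.ne_zero, hfac.inv_b.ne_zero] with x h1 h2 h3
  rw [h1]; exact div_ne_zero h2 h3

theorem d_ne_zero : ∀ᵐ x ∂circleMeasure, d x ≠ 0 := by
  filter_upwards [hfac.d_eq, ae_tilde hfac.inv_a.ne_zero, hfac.inv_b.ne_zero] with x h1 h2 h3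
  rw [h1]; exact div_ne_zero h2 h3

theorem cp_ne_zero : ∀ᵐ x ∂circleMeasure, cp x ≠ 0 := hfac.c_fac.ne_zero hfac.c_ne_zero

theorem dp_ne_zero : ∀ᵐ x ∂circleMeasure, dp x ≠ 0 := hfac.d_fac.ne_zero hfac.d_ne_zero

/-- Since `-(1-t)/(1-t⁻¹) = t = (1+t)/(1+t⁻¹)`, the function `(1-t)/((1+t) c₊)` is a factor
of `-c⁻¹ = -b/a`. -/
theorem neg_inv_fac : IsAntisymmFactor p q (fun x => -(b x / a x))
    (fun x => (1 - fourier 1 x) / ((1 + fourier 1 x) * cp x)) (-n) where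
  eq := by
    filter_upwards [hfac.c_eq, hfac.c_fac.eq, hfac.cp_ne_zero, ae_tilde hfac.cp_ne_zero,
      ae_one_add_ne_zero, ae_one_sub_ne_zero, hfac.inv_a.ne_zero, hfac.inv_b.ne_zero]
      with x h1 h2 h3 h4 h5 h6 h7 h8
    have h9 : b x / a x = (c x)⁻¹ := by rw [h1, inv_div]
    rw [h9, h2]
    simp only [tilde, fourier_neg_apply, fourier_neg_eq_inv, fourier_two_mul]
    have h10 := fourier_ne_zero n x
    have h11 := fourier_ne_zero 1 x
    have h12 : (1 : ℂ) - (fourier 1 x)⁻¹ ≠ 0 := by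
      intro h
      apply h6
      field_simp at h
      linear_combination -h
    have h13 : (1 : ℂ) + (fourier 1 x)⁻¹ ≠ 0 := by
      intro h
      apply h5
      field_simp at h
      linear_combination h
    have h14 : fourier 1 x - 1 ≠ (0 : ℂ) := fun h => h6 (by linear_combination -h)
    have h15 : fourier 1 x + 1 ≠ (0 : ℂ) := fun h => h5 (by linear_combination h)
    field_simp
    ring
  hardy := by
    refine hfac.c_fac.hardy_inv.congr ?_
    filter_upwards [ae_one_add_ne_zero, hfac.cp_ne_zero] with x h1 h2
    field_simp
  hardy_inv := by
    refine hfac.c_fac.hardy.congr ?_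
    filter_upwards [ae_one_sub_ne_zero, hfac.cp_ne_zero] with x h1 h2
    field_simp

theorem neg_inv_ne_zero : ∀ᵐ x ∂circleMeasure, -(b x / a x) ≠ 0 := by
  filter_upwards [hfac.inv_a.ne_zero, hfac.inv_b.ne_zero] with x h2 h3
  exact neg_ne_zero.2 (div_ne_zero h3 h2)

/-- By the factorizations of `c` and `d`, this amounts to `c d b̃⁻¹ = b⁻¹`, that is `a ã = b b̃`. -/
theorem rho_even : ∀ᵐ x ∂circleMeasure, rho b cp dp n m (-x) = rho b cp dp n m x := by
  filter_upwards [hfac.c_eq, hfac.c_fac.eq, hfac.d_eq, hfac.d_fac.eq, hfac.tilde_eq,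
    hfac.cp_ne_zero, ae_tilde hfac.cp_ne_zero, hfac.dp_ne_zero, ae_tilde hfac.dp_ne_zero,
    hfac.inv_b.ne_zero, ae_tilde hfac.inv_b.ne_zero]
    with x h1 h2 h3 h4 h5 h6 h7 h8 h9 h10 h11
  have h12 := fourier_ne_zero m x
  have h13 := fourier_ne_zero n x
  have h14 := fourier_ne_zero 1 x
  have hc : cp x = c x * (cp (-x) / fourier n x ^ 2) := by
    rw [h2, fourier_two_mul, tilde]; field_simp
  have hd : dp x = d x * (dp (-x) / fourier m x ^ 2) := by
    rw [h4, fourier_two_mul, tilde]; field_simp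
  simp only [rho, tilde, neg_neg, fourier_neg_apply, fourier_neg_eq_inv, fourier_sub_eq_div]
  rw [hc, hd, h1, h3]
  simp only [tilde] at h5 ⊢
  field_simp
  linear_combination (1 + fourier 1 x) ^ 2 * h5

theorem fourierCoeff_rho_neg (k : ℤ) :
    fourierCoeff (rho b cp dp n m) (-k) = fourierCoeff (rho b cp dp n m) k := by
  rw [← fourierCoeff_tilde]
  exact congrFun (fourierCoeff_congr_ae hfac.rho_even) k

theorem integrable_rho [hpq : p.HolderConjugate q] :
    Integrable (rho b cp dp n m) circleMeasure := by
  obtain ⟨b', hb'⟩ := hfac.inv_b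
  have hqp : q.HolderConjugate p := hpq.symm
  have h1 : MemLp (fun x => tilde (fun x => (1 + fourier 1 x) * cp x) x *
      tilde (fun x => (1 + fourier 1 x) * dp x) x) 1 circleMeasure :=
    (MemLp_tilde hfac.d_fac.hardy.1).mul (MemLp_tilde hfac.c_fac.hardy.1)
  have h2 := MemLp_fourier_mul h1 (1 - m - n)
  have h3 : MemLp (fun x => b' x * (fourier (1 - m - n) x *
      (tilde (fun x => (1 + fourier 1 x) * cp x) x *
      tilde (fun x => (1 + fourier 1 x) * dp x) x))) 1 circleMeasure :=
    h2.mul (Lp.memLp b')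
  refine (memLp_one_iff_integrable.1 h3).congr ?_
  filter_upwards [hb'] with x hx
  have hb : (b x)⁻¹ = b' x := (eq_inv_of_mul_eq_one_right hx).symm
  simp only [rho, tilde, hb, fourier_neg_apply, fourier_neg_eq_inv, fourier_sub_eq_div]
  have h12 := fourier_ne_zero m x
  have h13 := fourier_ne_zero n x
  have h14 := fourier_ne_zero 1 x
  field_simp
  ring

variable [Fact (1 ≤ p)]

/-- `J (L(a) + L(b) J) f` solves `h = d · J h`. -/
theorem flipOp_mulAddFlip_mem (f : Lp ℂ p circleMeasure)
    (hf : flipOp p (mulAddFlip p a b f) ∈ hardySpace p) :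
    flipOp p (mulAddFlip p a b f) ∈ flipEigenspace p d := by
  refine ⟨hf, ?_⟩
  filter_upwards [coeFn_flipOp (mulAddFlip p a b f), ae_tilde (coeFn_flipOp (mulAddFlip p a b f)),
    coeFn_mulAddFlip a b f, ae_tilde (coeFn_mulAddFlip a b f), hfac.d_eq, hfac.tilde_eq,
    hfac.inv_b.ne_zero] with x h1 h2 h3 h4 h5 h6 h7
  rw [h1, h2, neg_neg, h3, h4, h5, neg_neg]
  simp only [tilde] at h6 ⊢
  simp only [fourier_neg_apply, fourier_neg_eq_inv, inv_inv]
  have h14 := fourier_ne_zero 1 x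
  field_simp
  linear_combination (-f x * fourier 1 x) * h6

theorem mulAddFlip_eq_zero_iff (f : Lp ℂ p circleMeasure) (hf : f ∈ hardySpace p) :
    mulAddFlip p a b f = 0 ↔ f ∈ flipEigenspace p fun x => -(b x / a x) := by
  constructor
  · intro h
    refine ⟨hf, ?_⟩
    have h1 := coeFn_mulAddFlip a b f
    rw [h] at h1
    filter_upwards [h1, Lp.coeFn_zero ℂ p circleMeasure, hfac.inv_a.ne_zero] with x h1 h2 h3
    rw [h2, Pi.zero_apply] at h1
    field_simp
    linear_combination -h1
  · rintro ⟨-, h⟩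
    refine Lp.ext ?_
    filter_upwards [coeFn_mulAddFlip a b f, Lp.coeFn_zero ℂ p circleMeasure, h,
      hfac.inv_a.ne_zero] with x h1 h2 h3 h4
    rw [h1, h2, Pi.zero_apply]
    rw [h3]
    field_simp
    ring

variable [Fact (1 ≤ q)] [hpq : p.HolderConjugate q]

/-- For `h = J (L(a) + L(b) J) f`, the function `h̃ w / a` is `F + F̃` with `F = t f w ∈ t H^1`. -/
theorem integral_flipOp_mulAddFlip_mul (hp1 : 1 < p) (hp : p ≠ ∞) {f : Lp ℂ p circleMeasure}
    (hf : f ∈ hardySpace p) {w : Lp ℂ q circleMeasure} (hw : w ∈ flipEigenspace q c) :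
    ∫ x, flipOp p (mulAddFlip p a b f) (-x) * w x / a x ∂circleMeasure = 0 := by
  have hH := IsHardy.mul hp1 hp hf hw.1
  have h1 : Integrable (fun x => fourier 1 x * (f x * w x)) circleMeasure :=
    (MemLp_fourier_mul hH.1 1).integrable le_rfl
  have h2 : ∫ x, fourier 1 x * (f x * w x) ∂circleMeasure = 0 := by
    have := hH.2 (-1) (by norm_num)
    rwa [fourierCoeff_eq_integral_mul, neg_neg] at this
  have h3 : ∫ x, flipOp p (mulAddFlip p a b f) (-x) * w x / a x ∂circleMeasure =
      ∫ x, (fourier 1 x * (f x * w x) + fourier 1 (-x) * (f (-x) * w (-x))) ∂circleMeasure := by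
    refine integral_congr_ae ?_
    filter_upwards [ae_tilde (coeFn_flipOp (mulAddFlip p a b f)), coeFn_mulAddFlip a b f, hw.2,
      hfac.c_eq, hfac.inv_a.ne_zero, hfac.inv_b.ne_zero] with x h1 h2 h3 h4 h5 h6
    rw [h1, neg_neg, h2, h3, h4]
    simp only [fourier_neg_apply, fourier_neg_eq_inv, inv_inv]
    have h14 := fourier_ne_zero 1 x
    field_simp
  rw [h3, integral_add h1 h1.comp_neg,
    integral_neg_eq_self (fun x : UnitCircle => (fourier 1 x * (f x * w x) : ℂ)), h2, add_zero]

/-- For `h = d · J h` and `w = J (L(ã) + L(b) J) g`, the function `h̃ w / a` is `F + F̃` with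
`F = g̃ · J h`. -/
theorem integral_mul_flipOp_mulAddFlip {h : Lp ℂ p circleMeasure} (hh : h ∈ flipEigenspace p d)
    (g : Lp ℂ q circleMeasure) :
    ∫ x, h (-x) * flipOp q (mulAddFlip q (_root_.tildeOp ∞ a) b g) x / a x ∂circleMeasure =
      2 * circlePairing p q (flipOp p h) g := by
  have h1 : Integrable (fun x => flipOp p h x * g (-x)) circleMeasure :=
    memLp_one_iff_integrable.1 ((MemLp_tilde (Lp.memLp g)).mul (Lp.memLp _))
  have h3 : ∫ x, h (-x) * flipOp q (mulAddFlip q (_root_.tildeOp ∞ a) b g) x / a x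
      ∂circleMeasure = ∫ x, (flipOp p h x * g (-x) + flipOp p h (-x) * g (- -x))
        ∂circleMeasure := by
    refine integral_congr_ae ?_
    filter_upwards [coeFn_flipOp (mulAddFlip q (_root_.tildeOp ∞ a) b g),
      ae_tilde (coeFn_mulAddFlip (_root_.tildeOp ∞ a) b g), ae_tilde (coeFn_tildeOp a),
      coeFn_flipOp h, ae_tilde (coeFn_flipOp h), hh.2, hfac.d_eq, hfac.tilde_eq,
      hfac.inv_a.ne_zero, hfac.inv_b.ne_zero] with x h1 h2 h3 h4 h5 h6 h7 h8 h9 h10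
    rw [h1, h2, h3, h4, h5]
    simp only [neg_neg, tilde] at h8 ⊢
    rw [h6, h7]
    simp only [fourier_neg_apply, fourier_neg_eq_inv, inv_inv, tilde]
    have h14 := fourier_ne_zero 1 x
    field_simp
    linear_combination (-h (-x) * fourier 1 x * g x) * h8
  rw [h3, integral_add h1 h1.comp_neg,
    integral_neg_eq_self (fun x : UnitCircle => (flipOp p h x * g (-x) : ℂ)), circlePairing_apply]
  ring

end BasicFactorization

end Kernel

/-! ### The matrix of the pairing of the two solution spaces -/

section KernelDimension

open Filter Topology

variable {p q : ℝ≥0∞} {a b : Lp ℂ ∞ circleMeasure} {c d cp dp : UnitCircle → ℂ} {n m : ℤ}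

/-- For even integrable `r`, the bilinear form `∫ r s_x s_y` on even trigonometric polynomials is
twice that of the matrix `[r_{i-j} + r_{i+j}]`. -/
theorem integral_mul_evenPoly_mul_evenPoly {r : UnitCircle → ℂ} (hr : Integrable r circleMeasure)
    (heven : ∀ k, fourierCoeff r (-k) = fourierCoeff r k) {N M : ℕ} (x : Fin M → ℂ)
    (y : Fin N → ℂ) :
    ∫ t, r t * evenPoly x t * evenPoly y t ∂circleMeasure =
      2 * dotProduct y ((toeplitzHankelMatrix r N M).mulVec x) := by
  have hI : ∀ k : ℤ, Integrable (fun t => fourier k t * r t) circleMeasure := fun k =>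
    (MemLp_fourier_mul (memLp_one_iff_integrable.2 hr) k).integrable le_rfl
  have hIadd : ∀ k l : ℤ, Integrable (fun t => fourier k t * r t + fourier l t * r t)
      circleMeasure := fun k l => (hI k).add (hI l)
  have hval : ∀ k : ℤ, ∫ t, fourier k t * r t ∂circleMeasure = fourierCoeff r k := fun k => by
    rw [← heven, fourierCoeff_eq_integral_mul, neg_neg]
  have h1 : ∀ t : UnitCircle, r t * evenPoly x t * evenPoly y t =
      ∑ i : Fin N, ∑ j : Fin M, y i * x j * ((fourier ((i : ℤ) - j) t * r t +
        fourier (j - i : ℤ) t * r t) + (fourier (i + j : ℤ) t * r t +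
        fourier (-(i + j) : ℤ) t * r t)) := by
    intro t
    simp only [evenPoly, Finset.mul_sum, Finset.sum_mul]
    refine Finset.sum_congr rfl fun i _ => Finset.sum_congr rfl fun j _ => ?_
    simp only [fourier_sub_eq_div, fourier_neg_eq_inv, fourier_add]
    have := fourier_ne_zero i t
    have := fourier_ne_zero j t
    field_simp
    ring
  have hI2 : ∀ (i : Fin N) (j : Fin M), Integrable (fun t => y i * x j *
      ((fourier ((i : ℤ) - j) t * r t + fourier (j - i : ℤ) t * r t) +
        (fourier (i + j : ℤ) t * r t + fourier (-(i + j) : ℤ) t * r t))) circleMeasure :=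
    fun i j => ((hIadd _ _).add (hIadd _ _)).const_mul _
  simp only [h1]
  rw [integral_finsetSum _ fun i _ => integrable_finsetSum _ fun j _ => hI2 i j, dotProduct,
    Finset.mul_sum]
  refine Finset.sum_congr rfl fun i _ => ?_
  rw [integral_finsetSum _ fun j _ => hI2 i j, Matrix.mulVec, dotProduct, Finset.mul_sum,
    Finset.mul_sum]
  refine Finset.sum_congr rfl fun j _ => ?_
  rw [integral_const_mul, integral_add (hIadd _ _) (hIadd _ _),
    integral_add (hI _) (hI _), integral_add (hI _) (hI _), hval, hval, hval, hval,
    toeplitzHankelMatrix, Matrix.of_apply, heven, ← heven (j - i : ℤ), neg_sub]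
  ring

/-- The kernel of `T(a) + H(b)`, as a space of functions: all `f ∈ H^p` for which
`J (L(a) + L(b) J) f ∈ H^p`. -/
theorem mem_map_ker_iff [Fact (1 ≤ p)] (a b : Lp ℂ ∞ circleMeasure) (hp1 : 1 < p) (hp : p ≠ ∞)
    (f : Lp ℂ p circleMeasure) :
    f ∈ (LinearMap.ker (toeplitz p hp1 hp a + hankel p hp1 hp b).toLinearMap).map
        (hardySpace p).subtype ↔
      f ∈ hardySpace p ∧ flipOp p (mulAddFlip p a b f) ∈ hardySpace p := by
  rw [← rieszProjection_eq_zero_iff_flipOp_mem hp1 hp]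
  constructor
  · rintro ⟨f, hf, rfl⟩
    refine ⟨f.2, ?_⟩
    have h := congrArg (Subtype.val) (LinearMap.mem_ker.1 hf)
    exact (coe_toeplitz_add_hankel hp1 hp a b f).symm.trans h
  · rintro ⟨h1, h2⟩
    refine ⟨⟨f, h1⟩, LinearMap.mem_ker.2 (Subtype.ext ?_), rfl⟩
    exact (coe_toeplitz_add_hankel hp1 hp a b ⟨f, h1⟩).trans h2

namespace BasicFactorization

variable [Fact (1 ≤ p)] [Fact (1 ≤ q)] [hpq : p.HolderConjugate q]
variable (hfac : BasicFactorization p q a b c d cp dp n m)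

include hfac

/-- For `h = eigenMap x` and `w = eigenMap y`, the function `h̃ w / a` is `ρ s_x s_y` with the even
trigonometric polynomials `s_x`, `s_y`. -/
theorem integral_eigenMap_mul_eigenMap (x : Fin m.toNat → ℂ) (y : Fin n.toNat → ℂ) :
    ∫ t, eigenMap hfac.d_fac x (-t) * eigenMap hfac.c_fac y t / a t ∂circleMeasure =
      2 * dotProduct y
        ((toeplitzHankelMatrix (rho b cp dp n m) n.toNat m.toNat).mulVec x) := by
  rw [← integral_mul_evenPoly_mul_evenPoly hfac.integrable_rho hfac.fourierCoeff_rho_neg]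
  refine integral_congr_ae ?_
  filter_upwards [ae_tilde (coeFn_eigenMap hfac.d_fac x), coeFn_eigenMap hfac.c_fac y,
    hfac.c_eq, hfac.c_fac.eq, ae_tilde hfac.cp_ne_zero, hfac.inv_a.ne_zero, hfac.inv_b.ne_zero]
    with t h1 h2 h3 h4 h5 h6 h7
  have hn := fourier_ne_zero n t
  have hm := fourier_ne_zero m t
  have h1' := fourier_ne_zero 1 t
  have hc : cp t = c t * (cp (-t) / fourier n t ^ 2) := by
    rw [h4, fourier_two_mul, tilde]; field_simp
  rw [h1, h2, hc, h3, evenPoly_neg]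
  simp only [rho, tilde, fourier_neg_apply, fourier_neg_eq_inv, fourier_sub_eq_div]
  field_simp

/-- If `J (L(a) + L(b) J) f = h` for some `f ∈ H^p`, where `h` solves `h = d · J h`, then the
coordinates of `h` are in the kernel of the matrix. The converse holds as the range of
`L(a) + L(b) J` on `H^p` is closed. -/
theorem exists_flipOp_mulAddFlip_eq_iff (hp1 : 1 < p) (hp : p ≠ ∞)
    (hF : (toeplitz p hp1 hp a + hankel p hp1 hp b).IsFredholm) (x : Fin m.toNat → ℂ) :
    (∃ f ∈ hardySpace p, flipOp p (mulAddFlip p a b f) = eigenMap hfac.d_fac x) ↔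
      (toeplitzHankelMatrix (rho b cp dp n m) n.toNat m.toNat).mulVec x = 0 := by
  have hqp : q.HolderConjugate p := hpq.symm
  have hq1 : 1 < q := (ENNReal.HolderConjugate.lt_top_iff_one_lt p q).1 hp.lt_top
  have hq : q ≠ ∞ := ((ENNReal.HolderConjugate.lt_top_iff_one_lt q p).2 hp1).ne
  constructor
  · rintro ⟨f, hf, hfx⟩
    rw [← dotProduct_eq_zero_iff]
    intro y
    rw [dotProduct_comm]
    have h1 := hfac.integral_flipOp_mulAddFlip_mul hp1 hp hf
      (eigenMap_mem hfac.c_fac hfac.c_ne_zero y)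
    rw [hfx, hfac.integral_eigenMap_mul_eigenMap] at h1
    simpa using h1
  · intro hx
    set h := eigenMap hfac.d_fac x with hh
    have hhX : h ∈ flipEigenspace p d := eigenMap_mem hfac.d_fac hfac.d_ne_zero x
    let B : hardySpace p →L[ℂ] Lp ℂ p circleMeasure :=
      (mulAddFlip p a b).comp (hardySpace p).subtypeL
    let P : Lp ℂ p circleMeasure →L[ℂ] hardySpace p :=
      (rieszProjection p hp1 hp).codRestrict _ (rieszProjection_mem p hp1 hp)
    have hPB : P.comp B = toeplitz p hp1 hp a + hankel p hp1 hp b := by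
      ext1 f
      exact Subtype.ext (coe_toeplitz_add_hankel hp1 hp a b f).symm
    have hcl := isClosed_range_of_isFredholm_comp B P (hPB ▸ hF)
    by_contra hcon
    have hnot : flipOp p h ∉ LinearMap.range B.toLinearMap := by
      rintro ⟨f, hf⟩
      refine hcon ⟨f, f.2, ?_⟩
      have : mulAddFlip p a b f = flipOp p h := hf
      rw [this, flipOp_flipOp]
    obtain ⟨L, hL0, hLh⟩ := exists_functional_of_notMem hcl hnot
    obtain ⟨g, hg⟩ := exists_circlePairing_eq (q := q) hp1 hp L
    have hw : flipOp q (mulAddFlip q (tildeOp ∞ a) b g) ∈ flipEigenspace q c := by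
      refine hfac.symm.flipOp_mulAddFlip_mem g ?_
      rw [← rieszProjection_eq_zero_iff_flipOp_mem hq1 hq, rieszProjection_eq_zero_iff]
      intro k hk
      rw [← circlePairing_fourierLp_left (p := p), ← circlePairing_mulAddFlip, ← hg]
      exact hL0 _ ⟨⟨fourierLp p k, fourierLp_mem_hardySpace hk⟩, rfl⟩
    rw [← range_eigenMap hq1 hq hfac.c_fac hfac.c_ne_zero] at hw
    obtain ⟨y, hy⟩ := hw
    have h1 := hfac.integral_mul_flipOp_mulAddFlip hhX g
    rw [← hy, hfac.integral_eigenMap_mul_eigenMap, hx, dotProduct_zero, mul_zero, ← hg] at h1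
    exact hLh (by simpa using h1.symm)

/-- The dimension of the kernel: `f ↦ J (L(a) + L(b) J) f` maps `ker (T(a) + H(b))` onto a copy of
the kernel of the matrix, and its own kernel consists of the solutions of `f = -c⁻¹ · J f`. -/
theorem finrank_ker (hp1 : 1 < p) (hp : p ≠ ∞)
    (hF : (toeplitz p hp1 hp a + hankel p hp1 hp b).IsFredholm) :
    Module.finrank ℂ
        (LinearMap.ker (toeplitz p hp1 hp a + hankel p hp1 hp b).toLinearMap) =
      (-n).toNat + Module.finrank ℂ (LinearMap.ker (Matrix.toLin'
        (toeplitzHankelMatrix (rho b cp dp n m) n.toNat m.toNat))) := by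
  set K := (LinearMap.ker (toeplitz p hp1 hp a + hankel p hp1 hp b).toLinearMap).map
    (hardySpace p).subtype with hK
  have hKmem := mem_map_ker_iff a b hp1 hp
  have hfinker : FiniteDimensional ℂ
      (LinearMap.ker (toeplitz p hp1 hp a + hankel p hp1 hp b).toLinearMap) := hF.finite_ker
  have hKrank : Module.finrank ℂ
      (LinearMap.ker (toeplitz p hp1 hp a + hankel p hp1 hp b).toLinearMap) =
      Module.finrank ℂ K :=
    (Submodule.equivMapOfInjective _ (hardySpace p).subtype_injective _).finrank_eq
  have hKfin : FiniteDimensional ℂ K := inferInstance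
  let T : Lp ℂ p circleMeasure →ₗ[ℂ] Lp ℂ p circleMeasure :=
    ((flipOp p).comp (mulAddFlip p a b)).toLinearMap
  have hrange : LinearMap.range (T.domRestrict K) =
      (LinearMap.ker (Matrix.toLin'
        (toeplitzHankelMatrix (rho b cp dp n m) n.toNat m.toNat))).map (eigenMap hfac.d_fac) := by
    ext h
    constructor
    · rintro ⟨⟨f, hf⟩, rfl⟩
      obtain ⟨hf1, hf2⟩ := (hKmem f).1 hf
      have h1 := hfac.flipOp_mulAddFlip_mem f hf2
      rw [← range_eigenMap hp1 hp hfac.d_fac hfac.d_ne_zero] at h1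
      obtain ⟨x, hx⟩ := h1
      refine ⟨x, ?_, hx⟩
      rw [SetLike.mem_coe, LinearMap.mem_ker, Matrix.toLin'_apply]
      exact (hfac.exists_flipOp_mulAddFlip_eq_iff hp1 hp hF x).1 ⟨f, hf1, hx.symm⟩
    · rintro ⟨x, hx, rfl⟩
      rw [SetLike.mem_coe, LinearMap.mem_ker, Matrix.toLin'_apply] at hx
      obtain ⟨f, hf, hfx⟩ := (hfac.exists_flipOp_mulAddFlip_eq_iff hp1 hp hF x).2 hx
      refine ⟨⟨f, (hKmem f).2 ⟨hf, ?_⟩⟩, hfx⟩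
      rw [hfx]
      exact (eigenMap_mem hfac.d_fac hfac.d_ne_zero x).1
  have hker : LinearMap.ker (T.domRestrict K) =
      (flipEigenspace p fun x => -(b x / a x)).comap K.subtype := by
    ext ⟨f, hf⟩
    obtain ⟨hf1, hf2⟩ := (hKmem f).1 hf
    rw [LinearMap.mem_ker, Submodule.mem_comap]
    refine Iff.trans ?_ (hfac.mulAddFlip_eq_zero_iff f hf1)
    change flipOp p (mulAddFlip p a b f) = 0 ↔ _
    constructor
    · intro h
      rw [← flipOp_flipOp (mulAddFlip p a b f), h, map_zero]
    · intro h
      rw [h, map_zero]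
  have hle : (flipEigenspace p fun x => -(b x / a x)) ≤ K := by
    intro f hf
    refine (hKmem f).2 ⟨hf.1, ?_⟩
    rw [(hfac.mulAddFlip_eq_zero_iff f hf.1).2 hf, map_zero]
    exact zero_mem _
  rw [hKrank, ← LinearMap.finrank_range_add_finrank_ker (T.domRestrict K), hrange, hker,
    (Submodule.comapSubtypeEquivOfLe hle).finrank_eq,
    finrank_flipEigenspace hp1 hp hfac.neg_inv_fac hfac.neg_inv_ne_zero, add_comm,
    ← (Submodule.equivMapOfInjective _
      (eigenMap_injective hfac.d_fac hfac.d_ne_zero) _).finrank_eq]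

end BasicFactorization

end KernelDimension

/-! ### Adjoints of Fredholm operators -/

section FredholmAdjoint

open scoped LinearMap.FiniteRangeSetoid

variable {X : Type*} [NormedAddCommGroup X] [NormedSpace ℂ X]

theorem banachAdjoint_apply (A : X →L[ℂ] X) (φ : StrongDual ℂ X) :
    banachAdjoint A φ = φ.comp A := rfl

theorem hasFiniteRange_banachAdjoint {A : X →L[ℂ] X} (h : A.toLinearMap.HasFiniteRange) :
    (banachAdjoint A).toLinearMap.HasFiniteRange := by
  -- `A*` factors through the dual of the range of `A`
  set R := LinearMap.range A.toLinearMap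
  have : FiniteDimensional ℂ R := Module.Finite.iff_fg.2 (LinearMap.hasFiniteRange_iff_range.1 h)
  have hfin : FiniteDimensional ℂ (StrongDual ℂ R) :=
    Module.Finite.equiv (LinearMap.toContinuousLinearMap (𝕜 := ℂ) (E := R) (F' := ℂ))
  let A₀ : X →L[ℂ] R := A.codRestrict R fun x => LinearMap.mem_range_self A.toLinearMap x
  have hfac : (banachAdjoint A).toLinearMap =
      (ContinuousLinearMap.precomp ℂ A₀).toLinearMap ∘ₗ
        (ContinuousLinearMap.precomp ℂ R.subtypeL).toLinearMap := rfl
  rw [hfac]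
  exact (LinearMap.HasFiniteRange.of_finite_dom (f :=
    (ContinuousLinearMap.precomp ℂ A₀).toLinearMap)).comp_right _

theorem isQuasiInverse_banachAdjoint {A B : X →L[ℂ] X}
    (h : B.toLinearMap.IsQuasiInverse A.toLinearMap) :
    (banachAdjoint B).toLinearMap.IsQuasiInverse (banachAdjoint A).toLinearMap := by
  have key : ∀ S T : X →L[ℂ] X, S.toLinearMap ∘ₗ T.toLinearMap ≈ .id →
      (banachAdjoint T).toLinearMap ∘ₗ (banachAdjoint S).toLinearMap ≈ .id := by
    intro S T hST
    rw [LinearMap.FiniteRangeSetoid.equiv_iff_hasFiniteRange] at hST ⊢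
    have h1 : (S.comp T - ContinuousLinearMap.id ℂ X).toLinearMap.HasFiniteRange := hST
    have h2 := hasFiniteRange_banachAdjoint h1
    have h3 : (banachAdjoint T).toLinearMap ∘ₗ (banachAdjoint S).toLinearMap - .id =
        (banachAdjoint (S.comp T - ContinuousLinearMap.id ℂ X)).toLinearMap :=
      LinearMap.ext fun φ => ContinuousLinearMap.ext fun x => (map_sub φ _ _).symm
    rwa [h3]
  exact ⟨key A B h.2, key B A h.1⟩

theorem ContinuousLinearMap.IsFredholm.banachAdjoint {A : X →L[ℂ] X} (h : A.IsFredholm) :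
    (banachAdjoint A).IsFredholm := by
  obtain ⟨B, hB⟩ := h.exists_isQuasiInverse
  exact .of_isQuasiInverse (isQuasiInverse_banachAdjoint hB)

/-- The functionals annihilating the closed, finite-codimensional range of `A` are the linear
functionals on `X ⧸ im A`. -/
theorem finrank_ker_banachAdjoint {A : X →L[ℂ] X} (h : A.IsFredholm) :
    Module.finrank ℂ (LinearMap.ker (banachAdjoint A).toLinearMap) =
      Module.finrank ℂ (X ⧸ LinearMap.range A.toLinearMap) := by
  set R := LinearMap.range A.toLinearMap with hR
  have hcl : IsClosed (R : Set X) := h.isClosed_range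
  have hfin : FiniteDimensional ℂ (X ⧸ R) := h.finite_coker
  let e : Module.Dual ℂ (X ⧸ R) →ₗ[ℂ] StrongDual ℂ X :=
    (ContinuousLinearMap.precomp ℂ R.mkQL).toLinearMap ∘ₗ
      (LinearMap.toContinuousLinearMap (𝕜 := ℂ) (E := X ⧸ R) (F' := ℂ)).toLinearMap
  have he : ∀ ψ x, e ψ x = ψ (R.mkQ x) := fun _ _ => rfl
  have hinj : Function.Injective e := by
    intro ψ ψ' hψ
    ext x
    exact congrArg (fun φ : StrongDual ℂ X => φ x) hψ
  have hrange : LinearMap.range e = LinearMap.ker (banachAdjoint A).toLinearMap := by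
    ext φ
    constructor
    · rintro ⟨ψ, rfl⟩
      refine ContinuousLinearMap.ext fun x => ?_
      change e ψ (A x) = 0
      have h0 : R.mkQ (A x) = 0 :=
        (Submodule.Quotient.mk_eq_zero R).2 (LinearMap.mem_range_self A.toLinearMap x)
      rw [he, h0, map_zero]
    · intro hφ
      have hφ' : R ≤ LinearMap.ker φ.toLinearMap := by
        rintro _ ⟨x, rfl⟩
        exact congrArg (fun φ : StrongDual ℂ X => φ x) hφ
      exact ⟨R.liftQ φ.toLinearMap hφ', ContinuousLinearMap.ext fun x => rfl⟩
  rw [← hrange, LinearMap.finrank_range_of_inj hinj, Subspace.dual_finrank_eq]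

/-- Similar operators on different spaces are Fredholm together. -/
theorem ContinuousLinearMap.IsFredholm.of_equiv {Y : Type*} [NormedAddCommGroup Y]
    [NormedSpace ℂ Y] {A : X →L[ℂ] X} {B : Y →L[ℂ] Y} (e : Y ≃L[ℂ] X)
    (he : ∀ y, e (B y) = A (e y)) (h : A.IsFredholm) : B.IsFredholm := by
  obtain ⟨V, hV1, hV2⟩ := h.exists_isQuasiInverse
  have key : ∀ S T : X →L[ℂ] X, S.toLinearMap ∘ₗ T.toLinearMap ≈ .id →
      (e.symm.toLinearMap ∘ₗ S.toLinearMap ∘ₗ e.toLinearMap) ∘ₗ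
        (e.symm.toLinearMap ∘ₗ T.toLinearMap ∘ₗ e.toLinearMap) ≈ .id := by
    intro S T hST
    rw [LinearMap.FiniteRangeSetoid.equiv_iff_hasFiniteRange] at hST ⊢
    have h1 := (hST.comp_right e.toLinearMap).comp_left e.symm.toLinearMap
    have h2 : (e.symm.toLinearMap ∘ₗ S.toLinearMap ∘ₗ e.toLinearMap) ∘ₗ
        (e.symm.toLinearMap ∘ₗ T.toLinearMap ∘ₗ e.toLinearMap) - .id =
        e.symm.toLinearMap ∘ₗ (S.toLinearMap ∘ₗ T.toLinearMap - .id) ∘ₗ e.toLinearMap :=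
      LinearMap.ext fun y => by simp
    rwa [h2]
  have hB : B.toLinearMap = e.symm.toLinearMap ∘ₗ A.toLinearMap ∘ₗ e.toLinearMap := by
    ext y
    simp [← he]
  refine .of_isQuasiInverse (v := (e.symm : X →L[ℂ] Y).comp (V.comp (e : Y →L[ℂ] X))) ⟨?_, ?_⟩
  · rw [hB]; exact key V A hV1
  · rw [hB]; exact key A V hV2

theorem finrank_ker_eq_of_equiv {Y : Type*} [NormedAddCommGroup Y] [NormedSpace ℂ Y]
    {A : X →L[ℂ] X} {B : Y →L[ℂ] Y} (e : Y ≃L[ℂ] X) (he : ∀ y, e (B y) = A (e y)) :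
    Module.finrank ℂ (LinearMap.ker A.toLinearMap) =
      Module.finrank ℂ (LinearMap.ker B.toLinearMap) := by
  have hker : (LinearMap.ker B.toLinearMap).map e.toLinearEquiv.toLinearMap =
      LinearMap.ker A.toLinearMap := by
    ext x
    constructor
    · rintro ⟨y, hy, rfl⟩
      refine (he y).symm.trans ?_
      rw [show B y = 0 from hy, map_zero]
    · intro hx
      refine ⟨e.symm x, e.injective ?_, e.apply_symm_apply x⟩
      refine (he (e.symm x)).trans ?_
      rw [e.apply_symm_apply, map_zero]
      exact hx
  rw [← hker, LinearEquiv.finrank_map_eq]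

/-- If `Y` represents the dual of `X` and `B` the adjoint of the Fredholm operator `A`, then `B` is
Fredholm and its kernel has the dimension of that of the adjoint. -/
theorem isFredholm_and_finrank_ker_of_dual {Y : Type*} [NormedAddCommGroup Y]
    [NormedSpace ℂ Y] [CompleteSpace Y] {A : X →L[ℂ] X} {B : Y →L[ℂ] Y}
    (T : Y →L[ℂ] StrongDual ℂ X) (hT : Function.Bijective T)
    (hTB : ∀ y, T (B y) = banachAdjoint A (T y)) (hA : A.IsFredholm) :
    B.IsFredholm ∧ Module.finrank ℂ (LinearMap.ker (banachAdjoint A).toLinearMap) =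
      Module.finrank ℂ (LinearMap.ker B.toLinearMap) := by
  let e : Y ≃L[ℂ] StrongDual ℂ X := ContinuousLinearEquiv.ofBijective T
    (LinearMap.ker_eq_bot.2 hT.1) (LinearMap.range_eq_top.2 hT.2)
  exact ⟨hA.banachAdjoint.of_equiv e hTB, finrank_ker_eq_of_equiv e hTB⟩

end FredholmAdjoint

/-! ### The dual of the Hardy space -/

section HardyDual

variable {p q : ℝ≥0∞} [Fact (1 ≤ p)] [Fact (1 ≤ q)] [p.HolderConjugate q]

theorem isClosed_hardySpace (hp1 : 1 < p) (hp : p ≠ ∞) :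
    IsClosed (hardySpace p : Set (Lp ℂ p circleMeasure)) := by
  have h : (hardySpace p : Set (Lp ℂ p circleMeasure)) = {f | rieszProjection p hp1 hp f = f} := by
    ext f
    exact ⟨rieszProjection_eq_self hp1 hp, fun h => h ▸ rieszProjection_mem p hp1 hp f⟩
  rw [h]
  exact isClosed_eq (rieszProjection p hp1 hp).continuous continuous_id

/-- The map `H^q → (H^p)'` sending `g` to the functional `f ↦ ∑ f_k g_k`. -/
noncomputable def hardyDualMap (p q : ℝ≥0∞) [Fact (1 ≤ p)] [Fact (1 ≤ q)] [p.HolderConjugate q] :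
    hardySpace q →L[ℂ] StrongDual ℂ (hardySpace p) :=
  ((circlePairing p q).bilinearComp (hardySpace p).subtypeL (hardySpace q).subtypeL).flip

theorem hardyDualMap_apply (g : hardySpace q) (f : hardySpace p) :
    hardyDualMap p q g f = circlePairing p q f g := rfl

theorem hardyDualMap_injective : Function.Injective (hardyDualMap p q) := by
  rw [injective_iff_map_eq_zero]
  refine fun g hg => Subtype.ext (Lp_ext_fourierCoeff fun k => ?_)
  have h0 : fourierCoeff ((0 : hardySpace q) : Lp ℂ q circleMeasure) k = 0 := by
    rw [← circlePairing_fourierLp_left (p := p), ZeroMemClass.coe_zero, map_zero]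
  rw [h0]
  rcases lt_or_ge k 0 with hk | hk
  · exact g.2.2 k hk
  · have h1 := hardyDualMap_apply g (⟨fourierLp p k, fourierLp_mem_hardySpace hk⟩ : hardySpace p)
    rw [hg, circlePairing_fourierLp_left] at h1
    exact h1.symm

theorem hardyDualMap_surjective (hp1 : 1 < p) (hp : p ≠ ∞) (hq1 : 1 < q) (hq : q ≠ ∞) :
    Function.Surjective (hardyDualMap p q) := by
  intro φ
  obtain ⟨g, hg⟩ := exists_circlePairing_eq (q := q) hp1 hp (φ.comp
    ((rieszProjection p hp1 hp).codRestrict (hardySpace p) (rieszProjection_mem p hp1 hp)))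
  refine ⟨⟨rieszProjection q hq1 hq g, rieszProjection_mem q hq1 hq g⟩,
    ContinuousLinearMap.ext fun f => ?_⟩
  rw [hardyDualMap_apply, ← circlePairing_rieszProjection hp1 hp,
    rieszProjection_eq_self hp1 hp f.2, ← hg]
  exact congrArg φ (Subtype.ext (rieszProjection_eq_self hp1 hp f.2))

/-- Under `H^q ≅ (H^p)'`, the adjoint of `T(a) + H(b)` is `T(ã) + H(b)`. -/
theorem hardyDualMap_toeplitz_add_hankel (hp1 : 1 < p) (hp : p ≠ ∞) (hq1 : 1 < q) (hq : q ≠ ∞)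
    (a b : Lp ℂ ∞ circleMeasure) (g : hardySpace q) :
    hardyDualMap p q ((toeplitz q hq1 hq (tildeOp ∞ a) + hankel q hq1 hq b) g) =
      banachAdjoint (toeplitz p hp1 hp a + hankel p hp1 hp b) (hardyDualMap p q g) := by
  refine ContinuousLinearMap.ext fun f => ?_
  rw [banachAdjoint_apply, ContinuousLinearMap.comp_apply, hardyDualMap_apply, hardyDualMap_apply,
    coe_toeplitz_add_hankel, coe_toeplitz_add_hankel, circlePairing_rieszProjection hp1 hp hq1 hq,
    rieszProjection_eq_self hq1 hq g.2, circlePairing_mulAddFlip,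
    ← circlePairing_rieszProjection hp1 hp, rieszProjection_eq_self hp1 hp f.2]

end HardyDual

/-! ### The dimension formulas -/

theorem toeplitzHankelMatrix_transpose {r : UnitCircle → ℂ}
    (heven : ∀ k, fourierCoeff r (-k) = fourierCoeff r k) (N M : ℕ) :
    (toeplitzHankelMatrix r N M).transpose = toeplitzHankelMatrix r M N := by
  ext i j
  simp only [toeplitzHankelMatrix, Matrix.transpose_apply, Matrix.of_apply]
  rw [← heven, neg_sub, add_comm (j : ℤ)]

theorem rho_swap (b : Lp ℂ ∞ circleMeasure) (cp dp : UnitCircle → ℂ) (n m : ℤ) :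
    rho b dp cp m n = rho b cp dp n m := by
  funext x
  simp only [rho, show -n - m = -m - n by ring]
  ring

/-- The adjoint is an operator of the same type, with `(p, a, c, n)` and `(q, ã, d, m)`
exchanged. -/
theorem BasicFactorization.finrank_ker_banachAdjoint {p q : ℝ≥0∞} [Fact (1 ≤ p)] [Fact (1 ≤ q)]
    [hpq : p.HolderConjugate q] {a b : Lp ℂ ∞ circleMeasure} {c d cp dp : UnitCircle → ℂ} {n m : ℤ}
    (hfac : BasicFactorization p q a b c d cp dp n m) (hp1 : 1 < p) (hp : p ≠ ∞) (hq1 : 1 < q)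
    (hq : q ≠ ∞) (hF : (toeplitz p hp1 hp a + hankel p hp1 hp b).IsFredholm) :
    Module.finrank ℂ (LinearMap.ker
        (banachAdjoint (toeplitz p hp1 hp a + hankel p hp1 hp b)).toLinearMap) =
      (-m).toNat + Module.finrank ℂ (LinearMap.ker (Matrix.toLin'
        (toeplitzHankelMatrix (rho b cp dp n m) n.toNat m.toNat).transpose)) := by
  have hqp : q.HolderConjugate p := hpq.symm
  have : CompleteSpace (hardySpace q) := (isClosed_hardySpace hq1 hq).completeSpace_coe
  obtain ⟨hF', hker⟩ := isFredholm_and_finrank_ker_of_dual (hardyDualMap p q)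
    ⟨hardyDualMap_injective, hardyDualMap_surjective hp1 hp hq1 hq⟩
    (hardyDualMap_toeplitz_add_hankel hp1 hp hq1 hq a b) hF
  rw [hker, hfac.symm.finrank_ker hq1 hq hF', rho_swap,
    toeplitzHankelMatrix_transpose hfac.fourierCoeff_rho_neg]

/-- Row rank equals column rank. -/
theorem Matrix.finrank_ker_toLin'_add {K : Type*} [Field K] {N M : ℕ}
    (A : Matrix (Fin N) (Fin M) K) :
    Module.finrank K (LinearMap.ker (Matrix.toLin' A)) + N =
      Module.finrank K (LinearMap.ker (Matrix.toLin' A.transpose)) + M := by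
  have h1 := LinearMap.finrank_range_add_finrank_ker (Matrix.toLin' A)
  have h2 := LinearMap.finrank_range_add_finrank_ker (Matrix.toLin' A.transpose)
  have h3 : Module.finrank K (LinearMap.range (Matrix.toLin' A.transpose)) =
      Module.finrank K (LinearMap.range (Matrix.toLin' A)) := A.rank_transpose
  rw [Module.finrank_fin_fun] at h1 h2
  omega

theorem theorem4p2 (p q : ℝ≥0∞) [Fact (1 ≤ p)] (hp1 : 1 < p) (hp : p ≠ ∞) (hpq : p⁻¹ + q⁻¹ = 1)
    (a b : Lp ℂ ∞ circleMeasure) (c d cp dp : UnitCircle → ℂ) (n m : ℤ)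
    (hfac : BasicFactorization p q a b c d cp dp n m)
    (A : hardySpace p →L[ℂ] hardySpace p)
    (hA : A = toeplitz p hp1 hp a + hankel p hp1 hp b)
    (hF : A.IsFredholm)
    (Anm : Matrix (Fin n.toNat) (Fin m.toNat) ℂ)
    (hAnm : Anm = toeplitzHankelMatrix (rho b cp dp n m) n.toNat m.toNat) :
    Integrable (rho b cp dp n m) circleMeasure ∧
    -- the kernel of `T(a) + H(b)`
    FiniteDimensional ℂ (LinearMap.ker A.toLinearMap) ∧
    (0 < n → m ≤ 0 → Module.finrank ℂ (LinearMap.ker A.toLinearMap) = 0) ∧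
    (n ≤ 0 → m ≤ 0 → (Module.finrank ℂ (LinearMap.ker A.toLinearMap) : ℤ) = -n) ∧
    (0 < n → 0 < m → Module.finrank ℂ (LinearMap.ker A.toLinearMap) =
      Module.finrank ℂ (LinearMap.ker (Matrix.toLin' Anm))) ∧
    (n ≤ 0 → 0 < m → (Module.finrank ℂ (LinearMap.ker A.toLinearMap) : ℤ) = m - n) ∧
    -- the kernel of the adjoint
    FiniteDimensional ℂ (LinearMap.ker (banachAdjoint A).toLinearMap) ∧
    (0 < m → n ≤ 0 → Module.finrank ℂ (LinearMap.ker (banachAdjoint A).toLinearMap) = 0) ∧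
    (m ≤ 0 → n ≤ 0 → (Module.finrank ℂ (LinearMap.ker (banachAdjoint A).toLinearMap) : ℤ) = -m) ∧
    (0 < m → 0 < n → Module.finrank ℂ (LinearMap.ker (banachAdjoint A).toLinearMap) =
      Module.finrank ℂ (LinearMap.ker (Matrix.toLin' Anm.transpose))) ∧
    (m ≤ 0 → 0 < n → (Module.finrank ℂ (LinearMap.ker (banachAdjoint A).toLinearMap) : ℤ) = n - m) ∧
    -- the index
    fredholmIndex A = m - n := by
  have hpq' : p.HolderConjugate q := ⟨by rw [hpq, inv_one]⟩
  have hq1 : 1 < q := (ENNReal.HolderConjugate.lt_top_iff_one_lt p q).1 hp.lt_top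
  have hq : q ≠ ∞ := ((ENNReal.HolderConjugate.lt_top_iff_one_lt q p).2 hp1).ne
  have : Fact (1 ≤ q) := ⟨hq1.le⟩
  subst hA hAnm
  have hfinadj := hF.banachAdjoint.finite_ker
  have hker := hfac.finrank_ker hp1 hp hF
  have hadj := hfac.finrank_ker_banachAdjoint hp1 hp hq1 hq hF
  have hcoker := finrank_ker_banachAdjoint hF
  have hrank := Matrix.finrank_ker_toLin'_add
    (toeplitzHankelMatrix (rho b cp dp n m) n.toNat m.toNat)
  have hle := Submodule.finrank_le (LinearMap.ker (Matrix.toLin'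
    (toeplitzHankelMatrix (rho b cp dp n m) n.toNat m.toNat)))
  have hle' := Submodule.finrank_le (LinearMap.ker (Matrix.toLin'
    (toeplitzHankelMatrix (rho b cp dp n m) n.toNat m.toNat).transpose))
  rw [Module.finrank_fin_fun] at hle hle'
  refine ⟨hfac.integrable_rho, hF.finite_ker, ?_, ?_, ?_, ?_, hfinadj, ?_, ?_, ?_, ?_, ?_⟩
  -- if `n ≤ 0` or `m ≤ 0`, one of the kernels is trivial, and `hrank` determines the other
  iterate 8 intros; omega
  rw [fredholmIndex, ← hcoker]
  omega
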